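/- **Setting.** An oriented virtual knot $\mathcal K$ is an equivalence class of Gauss diagrams with one oriented core circle (finitely many chords, the classical crossings, each with a choice of over/under end and a sign) modulo isomorphism (isotopy) and all oriented Reidemeister moves $R1$, $R2$, $R3$; its members are the diagrams of $\mathcal K$. For a diagram $D$ let $\mathcal V(D)$ be the set of crossings and $\mathcal A(D)$ the set of arcs, i.e. of edges of the core circle between consecutive crossings (one closed arc if there are no crossings). The covering graph $\tilde D$ has vertex set $\mathcal V(D)$ and edge set $\mathcal A(D)$; it lies in the closed oriented surface $AD(D)$ obtained from the ribbon neighbourhood of the diagram by gluing discs, and for 1-cycles $\alpha$ (coefficients in $\mathbb Z$) and $\beta$ (coefficients in an abelian group $A$) of $\tilde D$, $\alpha\cdot\beta\in A$ denotes their intersection number in $AD(D)$; an intersection point counts $+1$ if the directions of $\alpha$ and $\beta$, in this order, form a positive frame. $D$ itself is a 1-cycle (the sum of all arcs). At a crossing $v$ let the left (right) incoming and outgoing arcs be those seen on the left (right) when both strands are directed upwards; the left half $D^l_v$ is the part of the knot that leaves $v$ along the left outgoing arc and comes back to $v$ along the left incoming arc. A move $D\to D'$ identifies the crossings of $D$ and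 $D'$ that it neither creates nor removes, and arcs $a\in\mathcal A(D)$, $a'\in\mathcal A(D')$ correspond to each other if they have a common point outside the region of the move. An *oriented parity* $p$ on the diagrams of $\mathcal K$ with coefficients in $A$ is a family of maps $p_D\colon\mathcal V(D)\to A$, one for each diagram $D$ of $\mathcal K$, such that: (P0) corresponding crossings have equal values; (P1) $p_D(v)=0$ if $v$ disappears in a decreasing first Reidemeister move; (P2) $p_D(v_1)+p_D(v_2)=0$ if $v_1,v_2$ disappear in a decreasing second Reidemeister move; (P3+) $\sum_{i=1}^3\epsilon_\Delta(v_i)\,p_D(v_i)=0$ if a third Reidemeister move applies to the triangle $\Delta$ with vertices $v_1,v_2,v_3$, where $\epsilon_\Delta(v_i)=1$ if at $v_i$ the triangle lies to the left or to the right of both strands (one side of $\Delta$ comes into $v_i$ and the other one leaves it) and $\epsilon_\Delta(v_i)=-1$ otherwise. For an arc $a$ of $D$, apply to $a$ and itself an increasing second Reidemeister move in which the two strands are parallel (in the notation of Gauss diagrams, the crossings $v,w,v,w$ are inserted in this order into $a$). The potential $\delta_a=\delta_{a,\bar a}\in A$ is the parity of the first new crossing $v$ in the resulting diagram. The parity cycle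 of $p$ in $D$ is the 1-chain $$\delta^p_D=\sum_{a\in\mathcal A(D)}\delta_a\cdot a\in C_1(\tilde D,A).$$ **Theorem.** Let $p$ be an oriented parity with coefficients in an abelian group $A$ on the diagrams of an oriented virtual knot $\mathcal K$. The potentials $\delta_a$ are well defined: they depend neither on which of the two strands goes over, nor on which of them is on the left, in the second Reidemeister move. Moreover: 1. for every diagram $D$ of $\mathcal K$, $\delta^p_D$ is a 1-cycle of $\tilde D$, i.e. $d\,\delta^p_D=0$; 2. the family $\delta^p_D$ is invariant: for any isotopy or Reidemeister move $D\to D'$ between diagrams of $\mathcal K$ and any corresponding arcs $a\in\mathcal A(D)$, $a'\in\mathcal A(D')$, the coefficient of $\delta^p_D$ at $a$ equals the coefficient of $\delta^p_{D'}$ at $a'$; 3. $\delta^p_D$ is normalized for every $D$: $D\cdot\delta^p_D=0$; 4. (intersection formula) $p_D(v)=D^l_v\cdot\delta^p_D$ for every diagram $D$ of $\mathcal K$ and every $v\in\mathcal V(D)$. -/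

import Mathlib

namespace VirtualKnot

/-! ## Gauss diagrams -/

/-- One passage of the knot through a classical crossing: the name of the crossing, whether the
passage is the overcrossing one, and whether the crossing is positive. -/
@[ext] structure Letter where
  label : ℕ
  isOver : Bool
  positive : Bool

namespace Letter

/-- The other passage through the same crossing. -/
def swap (l : Letter) : Letter := ⟨l.label, !l.isOver, l.positive⟩

/-- Renaming of crossings. -/
def relabel (σ : Equiv.Perm ℕ) (l : Letter) : Letter := ⟨σ l.label, l.isOver, l.positive⟩

/-- The strand of this passage crosses the other strand from left to right (with respect to the
direction of the other strand). At a positive crossing this is the over-strand, at a negative one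
the under-strand. -/
def goesRight (l : Letter) : Bool := l.isOver == l.positive

end Letter

/-- A Gauss diagram with one oriented core circle. The chords are the crossings, the letters of
`word` are the end points of the chords in the order in which they are met when one runs along the
core circle from some base point. Each crossing is met exactly twice, once over and once under. The
empty word is the diagram without crossings. -/
structure GaussDiagram where
  word : List Letter
  nodup : word.Nodup
  partner : ∀ l ∈ word, l.swap ∈ word
  coherent : ∀ l ∈ word, ∀ l' ∈ word, l.label = l'.label → l.positive = l'.positive

namespace GaussDiagram

/-- The names of the classical crossings. -/
def labels (D : GaussDiagram) : Finset ℕ := (D.word.map Letter.label).toFinset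

/-- The set of classical crossings of the diagram, that is of vertices of the covering graph. -/
abbrev Crossing (D : GaussDiagram) : Type := {x : ℕ // x ∈ D.labels}

/-- The number of arcs. The core circle of a diagram without crossings is one closed arc. -/
def arcCount (D : GaussDiagram) : ℕ := max 1 D.word.length

instance (D : GaussDiagram) : NeZero D.arcCount :=
  ⟨Nat.pos_iff_ne_zero.mp (lt_of_lt_of_le Nat.one_pos (le_max_left _ _))⟩

/-- The arcs of the diagram, that is the edges of the covering graph. Arc number `i` is the one
that ends at the letter number `i` (counted from `0`); arc `0` contains the base point. -/
abbrev Arc (D : GaussDiagram) : Type := Fin D.arcCount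

/-- The word read from a base point on the arc `i`. -/
def based (D : GaussDiagram) (i : D.Arc) : List Letter := D.word.rotate i.val

/-! ## The covering graph, its chains and the intersection number -/

/-- The position in the word of the passage through `v` of the strand that goes from left to right
(`r = true`) or from right to left (`r = false`). -/
def pos (D : GaussDiagram) (v : D.Crossing) (r : Bool) : ℕ :=
  D.word.findIdx fun l => l.label == v.1 && l.goesRight == r

/-- The arc on which a strand comes into `v`. It is the left one of the two incoming arcs if
`r = true`, and the right one if `r = false`. -/
def inArc (D : GaussDiagram) (v : D.Crossing) (r : Bool) : D.Arc :=
  Fin.ofNat D.arcCount (D.pos v r)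

/-- The arc on which a strand goes out of `v`. It is the right one of the two outgoing arcs if
`r = true`, and the left one if `r = false`. -/
def outArc (D : GaussDiagram) (v : D.Crossing) (r : Bool) : D.Arc :=
  Fin.ofNat D.arcCount (D.pos v r + 1)

/-- `0`-chains of the covering graph. -/
abbrev Chain0 (D : GaussDiagram) (A : Type*) : Type _ := D.Crossing → A

/-- `1`-chains of the covering graph; `γ` stands for the formal sum of the `γ a · a`. -/
abbrev Chain1 (D : GaussDiagram) (A : Type*) : Type _ := D.Arc → A

variable {A : Type*} [AddCommGroup A]

/-- The boundary map: the boundary of an arc is its end minus its start. -/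
def boundary (D : GaussDiagram) (γ : D.Chain1 A) : D.Chain0 A :=
  fun v => ∑ r : Bool, (γ (D.inArc v r) - γ (D.outArc v r))

/-- The intersection number `α · β` of two `1`-cycles of the covering graph on the oriented surface
of the abstract knot diagram; an intersection point counts `+1` if the directions of `α` and of `β`,
in this order, form a positively oriented frame. It is computed by shifting `α` to the left of
itself. Near a crossing, the shifted cycle then crosses (from right to left) the left incoming arc
with multiplicity the coefficient of `α` on the right incoming arc, and (from left to right) the
left outgoing arc with multiplicity the coefficient of `α` on the right outgoing arc. -/
def intersection (D : GaussDiagram) (α : D.Chain1 ℤ) (β : D.Chain1 A) : A :=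
  ∑ v : D.Crossing,
    (α (D.outArc v true) • β (D.outArc v false) - α (D.inArc v false) • β (D.inArc v true))

/-- The diagram itself as a `1`-cycle. -/
def fundamental (D : GaussDiagram) : D.Chain1 ℤ := fun _ => 1

/-- The left half of the diagram at the crossing `v`: the part of the knot that leaves `v` along the
left outgoing arc, and returns to `v` for the first time, along the left incoming arc. -/
def leftHalf (D : GaussDiagram) (v : D.Crossing) : D.Chain1 ℤ := fun k =>
  if (if D.pos v false < D.pos v true
      then D.pos v false < k.val ∧ k.val ≤ D.pos v true
      else D.pos v false < k.val ∨ k.val ≤ D.pos v true) then 1 else 0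

end GaussDiagram

/-! ## Moves

The words are read from a base point that lies outside the region of the move. -/

/-- `w'` is obtained from `w` by an increasing first Reidemeister move that creates `x`. -/
def IsR1 (x : ℕ) (w w' : List Letter) : Prop :=
  ∃ (o s : Bool) (u v : List Letter),
    w = u ++ v ∧ w' = u ++ [⟨x, o, s⟩, ⟨x, !o, s⟩] ++ v

/-- `w'` is obtained from `w` by an increasing second Reidemeister move that creates `x` and `y`.
The two strands are parallel if `d = true`, antiparallel if `d = false`. -/
def IsR2 (x y : ℕ) (w w' : List Letter) : Prop :=
  ∃ (o s d : Bool) (u v t : List Letter),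
    w = u ++ v ++ t ∧
    w' = u ++ [⟨x, o, s⟩, ⟨y, o, !s⟩] ++ v ++
      (if d then [⟨x, !o, s⟩, ⟨y, !o, !s⟩] else [⟨y, !o, !s⟩, ⟨x, !o, s⟩]) ++ t

/-- `w'` is obtained from `w` by a third Reidemeister move. Here `x`, `y`, `z` are the crossings of
the top and the middle strand, of the top and the bottom strand, and of the middle and the bottom
strand. If `κ = true` the sides of the triangle lie on the top, the middle and the bottom strand in
this order counterclockwise, otherwise clockwise. In the first case `t = true` (or `m = true`,
`b = true`) says that the top (middle, bottom) strand runs counterclockwise around the triangle,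
in the second case that it runs clockwise. These data determine the signs of the crossings and the
order of the crossings along each strand; the move reverses the order on all the three strands, and
the strands come in any order along the knot. -/
def IsR3 (x y z : ℕ) (t m b : Bool) (w w' : List Letter) : Prop :=
  ∃ κ : Bool,
    let sx := κ == (t == m)
    let sz := κ == (m == b)
    let sy := !(κ == (t == b))
    let top : List Letter :=
      if t then [⟨y, true, sy⟩, ⟨x, true, sx⟩] else [⟨x, true, sx⟩, ⟨y, true, sy⟩]
    let mid : List Letter :=
      if m then [⟨x, false, sx⟩, ⟨z, true, sz⟩] else [⟨z, true, sz⟩, ⟨x, false, sx⟩]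
    let bot : List Letter :=
      if b then [⟨z, false, sz⟩, ⟨y, false, sy⟩] else [⟨y, false, sy⟩, ⟨z, false, sz⟩]
    ∃ c₁ c₂ c₃ u₀ u₁ u₂ u₃ : List Letter,
      [c₁, c₂, c₃].Perm [top, mid, bot] ∧
      w = u₀ ++ c₁ ++ u₁ ++ c₂ ++ u₂ ++ c₃ ++ u₃ ∧
      w' = u₀ ++ c₁.reverse ++ u₁ ++ c₂.reverse ++ u₂ ++ c₃.reverse ++ u₃

/-- The incidence index to the triangle of the crossing of two of its sides: `1` if one of the
strands comes into the crossing along the triangle and the other one leaves it along the triangle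
(the triangle is on the left or on the right of the crossing), and `-1` otherwise. The arguments
tell in which direction the strands run around the triangle. -/
def incidence (a b : Bool) : ℤ := if a = b then 1 else -1

/-- Isotopies and (increasing) Reidemeister moves between words that are read from a common base
point outside the region of the move. The permutation `σ` is the correspondence of the crossings:
`v` corresponds to `σ v` whenever both are crossings of the respective diagrams. -/
inductive BasedMove : Equiv.Perm ℕ → List Letter → List Letter → Prop
  | isotopy (σ : Equiv.Perm ℕ) (w : List Letter) : BasedMove σ w (w.map (Letter.relabel σ))
  | r1 {x : ℕ} {w w' : List Letter} : IsR1 x w w' → BasedMove 1 w w'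
  | r2 {x y : ℕ} {w w' : List Letter} : IsR2 x y w w' → BasedMove 1 w w'
  | r3 {x y z : ℕ} {t m b : Bool} {w w' : List Letter} :
      IsR3 x y z t m b w w' → BasedMove 1 w w'

namespace GaussDiagram

/-- `D` and `D'` are related by one isotopy or Reidemeister move. -/
def Related (D D' : GaussDiagram) : Prop :=
  ∃ (i : D.Arc) (i' : D'.Arc) (σ : Equiv.Perm ℕ), BasedMove σ (D.based i) (D'.based i')

end GaussDiagram

/-- Oriented virtual knots: the equivalence classes of Gauss diagrams modulo Reidemeister moves. -/
def Knot : Type := Quot GaussDiagram.Related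

/-- The diagrams of a given virtual knot. -/
abbrev Diagram (K : Knot) : Type := {D : GaussDiagram // (Quot.mk _ D : Knot) = K}

/-! ## Oriented parities -/

/-- An oriented parity with coefficients in `A` on the diagrams of the virtual knot `K`. -/
structure OrientedParity (K : Knot) (A : Type*) [AddCommGroup A] where
  /-- The map on the crossings of each diagram. -/
  val : ∀ D : Diagram K, D.1.Crossing → A
  /-- Corresponding crossings have the same value. -/
  p0 : ∀ (D D' : Diagram K) (i : D.1.Arc) (i' : D'.1.Arc) (σ : Equiv.Perm ℕ),
    BasedMove σ (D.1.based i) (D'.1.based i') →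
    ∀ (v : D.1.Crossing) (v' : D'.1.Crossing), v'.1 = σ v.1 → val D v = val D' v'
  /-- A crossing that disappears in a first Reidemeister move has the value zero. -/
  p1 : ∀ (D D' : Diagram K) (i : D.1.Arc) (i' : D'.1.Arc) (x : D'.1.Crossing),
    IsR1 x.1 (D.1.based i) (D'.1.based i') → val D' x = 0
  /-- The values at the crossings that disappear in a second Reidemeister move sum to zero. -/
  p2 : ∀ (D D' : Diagram K) (i : D.1.Arc) (i' : D'.1.Arc) (x y : D'.1.Crossing),
    IsR2 x.1 y.1 (D.1.based i) (D'.1.based i') → val D' x + val D' y = 0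
  /-- The values at the crossings of a third Reidemeister move sum to zero with the incidence
  indices as coefficients. -/
  p3 : ∀ (D D' : Diagram K) (i : D.1.Arc) (i' : D'.1.Arc) (x y z : D.1.Crossing) (t m b : Bool),
    IsR3 x.1 y.1 z.1 t m b (D.1.based i) (D'.1.based i') →
    incidence t m • val D x + incidence t b • val D y + incidence m b • val D z = 0

/-! ## The second Reidemeister move of an arc with itself -/

namespace GaussDiagram

/-- A label not used by `D`; the next one is not used either. -/
def fresh (D : GaussDiagram) : ℕ := D.labels.sup id + 1

theorem label_lt_fresh (D : GaussDiagram) {l : Letter} (h : l ∈ D.word) : l.label < D.fresh := by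
  have h1 : l.label ∈ D.labels := by
    simp only [labels, List.mem_toFinset, List.mem_map]
    exact ⟨l, h, rfl⟩
  have h2 : l.label ≤ D.labels.sup id := Finset.le_sup (f := id) h1
  exact Nat.lt_succ_of_le h2

/-- The diagram obtained from `D` when the arc `i` is applied to itself in a second Reidemeister
move with parallel strands: the arc makes one turn and then runs along its own earlier part, and one
of these two strands is moved over the other one. The first of the new crossings along the arc is
called `D.fresh`, the second one `D.fresh + 1`. The strand that comes first goes over iff `o = true`;
at the first crossing it passes from the right to the left of the other strand iff `o ≠ s`. -/
def selfR2 (D : GaussDiagram) (i : D.Arc) (o s : Bool) : GaussDiagram where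
  word := [⟨D.fresh, o, s⟩, ⟨D.fresh + 1, o, !s⟩, ⟨D.fresh, !o, s⟩, ⟨D.fresh + 1, !o, !s⟩] ++
    D.based i
  nodup := by
    rw [List.nodup_append]
    refine ⟨by simp, List.nodup_rotate.mpr D.nodup, ?_⟩
    intro a ha b hb hab
    have hlt := D.label_lt_fresh (List.mem_rotate.mp hb)
    subst hab
    simp only [List.mem_cons, List.not_mem_nil, or_false] at ha
    rcases ha with rfl | rfl | rfl | rfl <;> simp at hlt
  partner := by
    intro l hl
    rw [List.mem_append] at hl ⊢
    rcases hl with hl | hl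
    · left
      simp only [List.mem_cons, List.not_mem_nil, or_false] at hl
      rcases hl with rfl | rfl | rfl | rfl <;> simp [Letter.swap]
    · right
      exact List.mem_rotate.mpr (D.partner l (List.mem_rotate.mp hl))
  coherent := by
    intro l hl l' hl' h
    rw [List.mem_append] at hl hl'
    rcases hl with hl | hl <;> rcases hl' with hl' | hl'
    · simp only [List.mem_cons, List.not_mem_nil, or_false] at hl hl'
      rcases hl with rfl | rfl | rfl | rfl <;> rcases hl' with rfl | rfl | rfl | rfl <;>
        simp_all
    · have hlt := D.label_lt_fresh (List.mem_rotate.mp hl')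
      simp only [List.mem_cons, List.not_mem_nil, or_false] at hl
      rcases hl with rfl | rfl | rfl | rfl <;> simp only at h <;> omega
    · have hlt := D.label_lt_fresh (List.mem_rotate.mp hl)
      simp only [List.mem_cons, List.not_mem_nil, or_false] at hl'
      rcases hl' with rfl | rfl | rfl | rfl <;> simp only at h <;> omega
    · exact D.coherent l (List.mem_rotate.mp hl) l' (List.mem_rotate.mp hl') h

theorem isR2_selfR2 (D : GaussDiagram) (i : D.Arc) (o s : Bool) :
    IsR2 D.fresh (D.fresh + 1) (D.based i) ((D.selfR2 i o s).based 0) := by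
  refine ⟨o, s, true, [], [], D.based i, by simp, ?_⟩
  simp [based, selfR2]

theorem fresh_mem_selfR2 (D : GaussDiagram) (i : D.Arc) (o s : Bool) :
    D.fresh ∈ (D.selfR2 i o s).labels := by
  simp [labels, selfR2]

end GaussDiagram

/-- The move of an arc over itself, as a diagram of the same knot. -/
def Diagram.selfR2 {K : Knot} (D : Diagram K) (i : D.1.Arc) (o s : Bool) : Diagram K :=
  ⟨D.1.selfR2 i o s,
    (Quot.sound ⟨i, 0, 1, BasedMove.r2 (D.1.isR2_selfR2 i o s)⟩ :
      (Quot.mk GaussDiagram.Related D.1) = Quot.mk _ (D.1.selfR2 i o s)).symm.trans D.2⟩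

variable {K : Knot} {A : Type*} [AddCommGroup A]

/-- The parity of the first of the two crossings that are produced by a second Reidemeister move of
an arc with itself. -/
def OrientedParity.selfParity (p : OrientedParity K A) (D : Diagram K) (i : D.1.Arc)
    (o s : Bool) : A :=
  p.val (D.selfR2 i o s) ⟨D.1.fresh, D.1.fresh_mem_selfR2 i o s⟩

/-- The potential of an arc. (It is the same for any `o` and `s`; here the strand that comes first
goes over, and from right to left at the first crossing.) -/
def OrientedParity.potential (p : OrientedParity K A) (D : Diagram K) (i : D.1.Arc) : A :=
  p.selfParity D i true false

/-- The parity cycle: the `1`-chain whose coefficients are the potentials of the arcs. -/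
def OrientedParity.parityCycle (p : OrientedParity K A) (D : Diagram K) : D.1.Chain1 A :=
  fun i => p.potential D i

/-- A family of `1`-chains is invariant if corresponding arcs have the same coefficient. Arcs
correspond to each other under a move if they have a common point outside the region of the move,
that is, if the move is a move of the words that are read from a base point on these arcs. -/
def IsInvariant (γ : ∀ D : Diagram K, D.1.Chain1 A) : Prop :=
  ∀ (D D' : Diagram K) (i : D.1.Arc) (i' : D'.1.Arc) (σ : Equiv.Perm ℕ),
    BasedMove σ (D.1.based i) (D'.1.based i') → γ D i = γ D' i'

/-- A `1`-cycle is normalized if its intersection number with the diagram is zero. -/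
def IsNormalized (D : GaussDiagram) (γ : D.Chain1 A) : Prop :=
  D.intersection D.fundamental γ = 0

end VirtualKnot

/-!
The parity of a crossing is a difference of two potentials, one for each of its strands; everything
else is read off from this.

A *bigon* is a pair of crossings produced by a second Reidemeister move of two arcs, which may
coincide. Three bigons between three arcs can be inserted so that a third Reidemeister move applies
to a triangle formed by one vertex of each of them. Erasing any two of the bigons does not change
the parity of the vertex of the remaining one, so this move gives a relation between the parities
of bigons of three *pairs* of arcs of the original diagram (`OrientedParity.bigonVal_triangle`). It
holds for all directions of the strands, and when one strand is on top, the heights of the other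
two are arbitrary; hence the parity of a bigon does not see which strand goes over
(`OrientedParity.bigonVal_over_eq`). With the right signs the relation becomes a cocycle condition
on directed strands (`OrientedParity.strandDiff_add`), so that there is a function
`Φ = strandPotential` of the arcs and of a direction `d` whose differences are the parities of the
bigons. A bigon of an arc with itself, with antiparallel strands, has parity zero by the first
Reidemeister move, so `Φ` is well defined on arcs, and the parity of a parallel self-bigon, that is
the potential `δ` of the arc, is `Φ(·, true) - Φ(·, false)` in all four cases.

A bigon of the strands of a crossing `v` may be inserted next to `v`, in any of the four corners,
so that `v` and a vertex of it cancel each other in another second Reidemeister move. Therefore the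
parity of `v` is a difference of values of `Φ` in four ways
(`OrientedParity.val_eq_strandPotential_sub`). Let `b` be the strand that goes from left to right
at `v`, and `c` the other one. Comparing the four expressions yields `dδ = 0`, and moreover
`Φ(b_out, true) - Φ(b_in, true) = -δ(c_out)` and `Φ(c_out, true) - Φ(c_in, true) = δ(b_in)`. These
steps are the contributions to an intersection number with `δ`, up to sign
(`OrientedParity.intersection_parityCycle`), so that both intersection numbers are telescoping sums
of `Φ(·, true)`: over the whole circle the sum is zero, over the left half of `v` it is one of the
four expressions for the parity of `v`.

Parities are handled as functions of words and labels (`OrientedParity.wordVal`), which removes the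
dependence on diagrams and on the choice of a base point.
-/

namespace VirtualKnot

/-! ### Gauss words -/

/-- The words of Gauss diagrams. -/
structure IsGauss (w : List Letter) : Prop where
  nodup : w.Nodup
  partner : ∀ l ∈ w, l.swap ∈ w
  coherent : ∀ l ∈ w, ∀ l' ∈ w, l.label = l'.label → l.positive = l'.positive

/-- The label `x` does not occur in the word `w`. -/
def Unused (x : ℕ) (w : List Letter) : Prop := ∀ l ∈ w, l.label ≠ x

theorem Letter.swap_swap (l : Letter) : l.swap.swap = l := by
  simp [Letter.swap]

theorem unused_append {x : ℕ} {u v : List Letter} :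
    Unused x (u ++ v) ↔ Unused x u ∧ Unused x v := by
  simp only [Unused, List.mem_append]
  exact ⟨fun h => ⟨fun l hl => h l (Or.inl hl), fun l hl => h l (Or.inr hl)⟩,
    fun h l hl => hl.elim (h.1 l) (h.2 l)⟩

/-- A label that exceeds all the labels of a word. -/
def freshLabel (w : List Letter) : ℕ := (w.map Letter.label).toFinset.sup id + 1

theorem unused_of_freshLabel_le {w : List Letter} {x : ℕ} (hx : freshLabel w ≤ x) :
    Unused x w := by
  intro l hl h
  have h1 : l.label ≤ (w.map Letter.label).toFinset.sup id :=
    Finset.le_sup (f := id) (by simpa using ⟨l, hl, rfl⟩)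
  unfold freshLabel at hx
  omega

namespace IsGauss

theorem perm {w w' : List Letter} (h : IsGauss w) (hp : w.Perm w') : IsGauss w' where
  nodup := hp.nodup_iff.mp h.nodup
  partner l hl := hp.mem_iff.mp (h.partner l (hp.mem_iff.mpr hl))
  coherent l hl l' hl' := h.coherent l (hp.mem_iff.mpr hl) l' (hp.mem_iff.mpr hl')

theorem cons_chord {w : List Letter} (h : IsGauss w) {x : ℕ} (hx : Unused x w) (o s : Bool) :
    IsGauss (⟨x, o, s⟩ :: ⟨x, !o, s⟩ :: w) where
  nodup := by
    simp only [List.nodup_cons, List.mem_cons, not_or]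
    refine ⟨⟨by simp, fun hm => hx _ hm rfl⟩, fun hm => hx _ hm rfl, h.nodup⟩
  partner l hl := by
    simp only [List.mem_cons] at hl ⊢
    rcases hl with rfl | rfl | hl
    · simp [Letter.swap]
    · simp [Letter.swap]
    · exact Or.inr (Or.inr (h.partner l hl))
  coherent l hl l' hl' hll := by
    simp only [List.mem_cons] at hl hl'
    rcases hl with rfl | rfl | hl <;> rcases hl' with rfl | rfl | hl' <;>
      first
      | rfl
      | exact absurd hll.symm (hx _ hl')
      | exact absurd hll (hx _ hl)
      | exact h.coherent l hl l' hl' hll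

theorem unused_of_cons_chord {w : List Letter} {x : ℕ} {o s : Bool}
    (h : IsGauss (⟨x, o, s⟩ :: ⟨x, !o, s⟩ :: w)) : Unused x w := by
  rintro l hl rfl
  obtain ⟨h1, h2⟩ := List.nodup_cons.mp h.nodup
  obtain ⟨h2, -⟩ := List.nodup_cons.mp h2
  have hs : s = l.positive := h.coherent _ (List.mem_cons_self ..) l (by simp [hl]) rfl
  simp only [List.mem_cons, not_or] at h1
  obtain ⟨n, o', s'⟩ := l
  subst hs
  by_cases ho : o' = o
  · subst ho
    exact h1.2 hl
  · rw [← Bool.eq_not.mpr ho] at h2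
    exact h2 hl

theorem of_cons_chord {w : List Letter} {x : ℕ} {o s : Bool}
    (h : IsGauss (⟨x, o, s⟩ :: ⟨x, !o, s⟩ :: w)) : IsGauss w where
  nodup := (List.nodup_cons.mp (List.nodup_cons.mp h.nodup).2).2
  partner l hl := by
    obtain ⟨h1, h2⟩ := List.nodup_cons.mp h.nodup
    obtain ⟨h2, -⟩ := List.nodup_cons.mp h2
    have h3 := h.partner l (by simp [hl])
    simp only [List.mem_cons, not_or] at h3 h1 h2
    rcases h3 with h3 | h3 | h3
    · have : l = ⟨x, !o, s⟩ := by rw [← l.swap_swap, h3]; rfl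
      exact absurd (this ▸ hl) h2
    · have : l = ⟨x, o, s⟩ := by rw [← l.swap_swap, h3]; simp [Letter.swap]
      exact absurd (this ▸ hl) h1.2
    · exact h3
  coherent l hl l' hl' := h.coherent l (by simp [hl]) l' (by simp [hl'])

end IsGauss

theorem GaussDiagram.isGauss (D : GaussDiagram) : IsGauss D.word :=
  ⟨D.nodup, D.partner, D.coherent⟩

theorem GaussDiagram.eq_of_word_eq {D D' : GaussDiagram} (h : D.word = D'.word) : D = D' := by
  cases D; cases D'; cases h; rfl

theorem GaussDiagram.mem_labels {D : GaussDiagram} {n : ℕ} :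
    n ∈ D.labels ↔ n ∈ D.word.map Letter.label := by
  simp [labels]

theorem GaussDiagram.based_zero (D : GaussDiagram) : D.based 0 = D.word := by
  simp [based]

theorem map_relabel_one (w : List Letter) : w.map (Letter.relabel 1) = w := by
  have : Letter.relabel 1 = id := by ext l <;> rfl
  simp [this]

theorem map_relabel_eq_self {σ : Equiv.Perm ℕ} {w : List Letter}
    (h : ∀ l ∈ w, σ l.label = l.label) : w.map (Letter.relabel σ) = w := by
  conv_rhs => rw [← List.map_id w]
  refine List.map_congr_left fun l hl => ?_
  simp [Letter.relabel, h l hl]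

/-! ### Parities as functions of words -/

/-- The word `w` is the word of a diagram of the knot `K`. -/
def OnKnot (K : Knot) (w : List Letter) : Prop := ∃ D : Diagram K, D.1.word = w

namespace OnKnot

variable {K : Knot} {w w' : List Letter}

theorem isGauss (h : OnKnot K w) : IsGauss w := by
  obtain ⟨D, rfl⟩ := h
  exact D.1.isGauss

theorem of_based {D : GaussDiagram} (i : D.Arc) {σ : Equiv.Perm ℕ}
    (hD : (Quot.mk _ D : Knot) = K) (hw : IsGauss w) (hm : BasedMove σ (D.based i) w) :
    OnKnot K w := by
  let D' : GaussDiagram := ⟨w, hw.nodup, hw.partner, hw.coherent⟩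
  refine ⟨⟨D', ?_⟩, rfl⟩
  rw [← hD]
  refine (Quot.sound ⟨i, 0, σ, ?_⟩).symm
  rw [D'.based_zero]
  exact hm

theorem move (h : OnKnot K w) (hw : IsGauss w') {σ : Equiv.Perm ℕ} (hm : BasedMove σ w w') :
    OnKnot K w' := by
  obtain ⟨D, rfl⟩ := h
  exact of_based 0 D.2 hw (by rwa [D.1.based_zero])

theorem move_inv (h : OnKnot K w') (hw : IsGauss w) {σ : Equiv.Perm ℕ}
    (hm : BasedMove σ w w') : OnKnot K w := by
  obtain ⟨D, rfl⟩ := h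
  let D' : GaussDiagram := ⟨w, hw.nodup, hw.partner, hw.coherent⟩
  refine ⟨⟨D', ?_⟩, rfl⟩
  rw [← D.2]
  refine Quot.sound ⟨0, 0, σ, ?_⟩
  rw [D'.based_zero, D.1.based_zero]
  exact hm

theorem based (D : Diagram K) (i : D.1.Arc) : OnKnot K (D.1.based i) := by
  refine of_based i (σ := 1) D.2 (D.1.isGauss.perm (List.rotate_perm _ _).symm) ?_
  conv => arg 3; rw [← map_relabel_one (D.1.based i)]
  exact .isotopy 1 _

end OnKnot

theorem GaussDiagram.exists_based_eq (D : GaussDiagram) {u v : List Letter}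
    (h : D.word = u ++ v) : ∃ i : D.Arc, D.based i = v ++ u := by
  rcases eq_or_ne v [] with rfl | hv
  · exact ⟨0, by simp [D.based_zero, h]⟩
  · have hlt : u.length < D.arcCount := by
      have : 0 < v.length := List.length_pos_iff.mpr hv
      simp only [arcCount, h, List.length_append]
      omega
    exact ⟨⟨u.length, hlt⟩, by simp [based, h]⟩

theorem OnKnot.rotate {K : Knot} {u v : List Letter} (h : OnKnot K (u ++ v)) :
    OnKnot K (v ++ u) := by
  obtain ⟨D, hD⟩ := h
  obtain ⟨i, hi⟩ := D.1.exists_based_eq hD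
  exact hi ▸ OnKnot.based D i

namespace OrientedParity

variable {K : Knot} {A : Type*} [AddCommGroup A] (p : OrientedParity K A)
  {w w' : List Letter} {n : ℕ}

open Classical in
/-- The parity of the crossing `n` of the diagram with the word `w`; zero if there is no such
crossing. -/
noncomputable def wordVal (w : List Letter) (n : ℕ) : A :=
  if h : ∃ D : Diagram K, D.1.word = w ∧ n ∈ D.1.labels then
    p.val h.choose ⟨n, h.choose_spec.2⟩ else 0

theorem val_eq_wordVal (D : Diagram K) (v : D.1.Crossing) :
    p.val D v = p.wordVal D.1.word v.1 := by
  have h : ∃ E : Diagram K, E.1.word = D.1.word ∧ v.1 ∈ E.1.labels := ⟨D, rfl, v.2⟩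
  rw [wordVal, dif_pos h]
  have hE : h.choose = D := Subtype.ext (GaussDiagram.eq_of_word_eq h.choose_spec.1)
  have key : ∀ (E : Diagram K) (hv : v.1 ∈ E.1.labels), E = D → p.val D v = p.val E ⟨v.1, hv⟩ := by
    rintro E hv rfl
    rfl
  exact key _ h.choose_spec.2 hE

theorem wordVal_eq_val (D : Diagram K) (hn : n ∈ D.1.word.map Letter.label) :
    p.wordVal D.1.word n = p.val D ⟨n, GaussDiagram.mem_labels.mpr hn⟩ :=
  (p.val_eq_wordVal D ⟨n, _⟩).symm

theorem wordVal_move (h : OnKnot K w) (h' : OnKnot K w') {σ : Equiv.Perm ℕ}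
    (hm : BasedMove σ w w') (hn : n ∈ w.map Letter.label) (hn' : σ n ∈ w'.map Letter.label) :
    p.wordVal w n = p.wordVal w' (σ n) := by
  obtain ⟨D, rfl⟩ := h
  obtain ⟨D', rfl⟩ := h'
  rw [p.wordVal_eq_val D hn, p.wordVal_eq_val D' hn']
  exact p.p0 D D' 0 0 σ (by rwa [D.1.based_zero, D'.1.based_zero]) _ _ rfl

theorem wordVal_based (D : Diagram K) (i : D.1.Arc) (hn : n ∈ D.1.word.map Letter.label) :
    p.wordVal (D.1.based i) n = p.wordVal D.1.word n := by
  obtain ⟨D', hD'⟩ := OnKnot.based D i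
  have hn' : n ∈ D'.1.word.map Letter.label := by
    rw [hD']
    exact ((List.rotate_perm _ _).map _).mem_iff.mpr hn
  rw [← hD', p.wordVal_eq_val D hn, p.wordVal_eq_val D' hn']
  refine (p.p0 D D' i 0 1 ?_ _ _ rfl).symm
  rw [D'.1.based_zero, hD']
  conv => arg 3; rw [← map_relabel_one (D.1.based i)]
  exact .isotopy 1 _

theorem wordVal_rotate {u v : List Letter} (h : OnKnot K (u ++ v))
    (hn : n ∈ (u ++ v).map Letter.label) : p.wordVal (v ++ u) n = p.wordVal (u ++ v) n := by
  obtain ⟨D, hD⟩ := h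
  obtain ⟨i, hi⟩ := D.1.exists_based_eq hD
  rw [← hi, ← hD]
  exact p.wordVal_based D i (hD ▸ hn)

theorem wordVal_r1 {x : ℕ} (h : OnKnot K w) (h' : OnKnot K w') (hm : IsR1 x w w') :
    p.wordVal w' x = 0 := by
  have hx : x ∈ w'.map Letter.label := by
    obtain ⟨o, s, u, v, rfl, rfl⟩ := hm
    simp
  obtain ⟨D, rfl⟩ := h
  obtain ⟨D', rfl⟩ := h'
  rw [p.wordVal_eq_val D' hx]
  exact p.p1 D D' 0 0 _ (by rwa [D.1.based_zero, D'.1.based_zero])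

theorem wordVal_r2 {x y : ℕ} (h : OnKnot K w) (h' : OnKnot K w') (hm : IsR2 x y w w') :
    p.wordVal w' x + p.wordVal w' y = 0 := by
  have hx : x ∈ w'.map Letter.label ∧ y ∈ w'.map Letter.label := by
    obtain ⟨o, s, d, u, v, t, rfl, rfl⟩ := hm
    simp
  obtain ⟨D, rfl⟩ := h
  obtain ⟨D', rfl⟩ := h'
  rw [p.wordVal_eq_val D' hx.1, p.wordVal_eq_val D' hx.2]
  exact p.p2 D D' 0 0 _ _ (by rwa [D.1.based_zero, D'.1.based_zero])

end OrientedParity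

theorem IsR3.perm {x y z : ℕ} {t m b : Bool} {w w' : List Letter} (h : IsR3 x y z t m b w w') :
    w.Perm w' := by
  obtain ⟨κ, c₁, c₂, c₃, u₀, u₁, u₂, u₃, -, rfl, rfl⟩ := h
  have := (List.reverse_perm c₁).symm
  have := (List.reverse_perm c₂).symm
  have := (List.reverse_perm c₃).symm
  gcongr

theorem IsR3.mem_labels {x y z : ℕ} {t m b : Bool} {w w' : List Letter}
    (h : IsR3 x y z t m b w w') : x ∈ w.map Letter.label ∧ y ∈ w.map Letter.label ∧
      z ∈ w.map Letter.label := by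
  obtain ⟨κ, c₁, c₂, c₃, u₀, u₁, u₂, u₃, hp, rfl, -⟩ := h
  have hsub : ∀ c ∈ [c₁, c₂, c₃], ∀ n ∈ c.map Letter.label,
      n ∈ (u₀ ++ c₁ ++ u₁ ++ c₂ ++ u₂ ++ c₃ ++ u₃).map Letter.label := by
    intro c hc n hn
    simp only [List.mem_cons, List.not_mem_nil, or_false] at hc
    simp only [List.map_append, List.mem_append]
    rcases hc with rfl | rfl | rfl <;> simp only [hn, true_or, or_true]
  refine ⟨hsub _ (hp.mem_iff.mpr (List.mem_cons_self ..)) _ ?_,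
    hsub _ (hp.mem_iff.mpr (List.mem_cons_self ..)) _ ?_,
    hsub _ (hp.mem_iff.mpr (List.mem_cons_of_mem _ (List.mem_cons_self ..))) _ ?_⟩
  · cases t <;> simp
  · cases t <;> simp
  · cases m <;> simp

theorem OrientedParity.wordVal_r3 {K : Knot} {A : Type*} [AddCommGroup A]
    (p : OrientedParity K A) {w w' : List Letter} {x y z : ℕ} {t m b : Bool}
    (h : OnKnot K w) (hm : IsR3 x y z t m b w w') :
    incidence t m • p.wordVal w x + incidence t b • p.wordVal w y +
      incidence m b • p.wordVal w z = 0 := by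
  obtain ⟨D', rfl⟩ := h.move (h.isGauss.perm hm.perm) (.r3 hm)
  obtain ⟨hx, hy, hz⟩ := hm.mem_labels
  obtain ⟨D, rfl⟩ := h
  rw [p.wordVal_eq_val D hx, p.wordVal_eq_val D hy, p.wordVal_eq_val D hz]
  exact p.p3 D D' 0 0 _ _ _ t m b (by rwa [D.1.based_zero, D'.1.based_zero])

/-! ### Bigons -/

/-- One side of a bigon with the vertices `x` and `y`, on the strand that goes over iff `o = true`.
The crossing `x` has the sign `s`, the crossing `y` the opposite one. The strand meets `x` first iff
`e = true`. -/
def bigonSide (x y : ℕ) (o s e : Bool) : List Letter :=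
  if e then [⟨x, o, s⟩, ⟨y, o, !s⟩] else [⟨y, o, !s⟩, ⟨x, o, s⟩]

theorem bigonSide_swap (x y : ℕ) (o s e : Bool) :
    bigonSide x y o (!s) (!e) = bigonSide y x o s e := by
  cases e <;> simp [bigonSide]

theorem mem_bigonSide (x y : ℕ) (o s e : Bool) :
    x ∈ (bigonSide x y o s e).map Letter.label := by
  cases e <;> simp [bigonSide]

theorem unused_bigonSide {n x y : ℕ} {o s e : Bool} :
    Unused n (bigonSide x y o s e) ↔ n ≠ x ∧ n ≠ y := by
  cases e <;> simp [Unused, bigonSide, eq_comm, and_comm]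

theorem map_relabel_bigonSide (σ : Equiv.Perm ℕ) (x y : ℕ) (o s e : Bool) :
    (bigonSide x y o s e).map (Letter.relabel σ) = bigonSide (σ x) (σ y) o s e := by
  cases e <;> simp [bigonSide, Letter.relabel]

section Insert

variable {u v t : List Letter} {x y : ℕ} {o s e₁ e₂ : Bool}

theorem perm_bigonSide (u v t : List Letter) (x y : ℕ) (o s e₁ e₂ : Bool) :
    (u ++ bigonSide x y o s e₁ ++ v ++ bigonSide x y (!o) s e₂ ++ t).Perm
      (⟨x, o, s⟩ :: ⟨x, !o, s⟩ :: ⟨y, o, !s⟩ :: ⟨y, !o, !s⟩ :: (u ++ v ++ t)) := by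
  rw [← Multiset.coe_eq_coe]
  cases e₁ <;> cases e₂ <;>
  · simp only [bigonSide, ← Multiset.coe_add, ← Multiset.cons_coe, ← Multiset.singleton_add,
      Multiset.coe_nil, if_true, if_false, Bool.false_eq_true]
    abel

theorem isR2_bigonSide (u v t : List Letter) (x y : ℕ) (o s e₂ : Bool) :
    IsR2 x y (u ++ v ++ t)
      (u ++ bigonSide x y o s true ++ v ++ bigonSide x y (!o) s e₂ ++ t) :=
  ⟨o, s, e₂, u, v, t, rfl, rfl⟩

theorem basedMove_bigonSide (u v t : List Letter) (x y : ℕ) (o s e₁ e₂ : Bool) :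
    BasedMove 1 (u ++ v ++ t)
      (u ++ bigonSide x y o s e₁ ++ v ++ bigonSide x y (!o) s e₂ ++ t) := by
  cases e₁
  · have h := isR2_bigonSide u v t y x o (!s) (!e₂)
    rw [← Bool.not_false, bigonSide_swap, bigonSide_swap] at h
    exact .r2 h
  · exact .r2 (isR2_bigonSide u v t x y o s e₂)

variable {K : Knot}

theorem OnKnot.insert_bigon (h : OnKnot K (u ++ v ++ t)) (hxy : x ≠ y)
    (hx : Unused x (u ++ v ++ t)) (hy : Unused y (u ++ v ++ t)) :
    OnKnot K (u ++ bigonSide x y o s e₁ ++ v ++ bigonSide x y (!o) s e₂ ++ t) := by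
  refine h.move (.perm ?_ (perm_bigonSide u v t x y o s e₁ e₂).symm)
    (basedMove_bigonSide u v t x y o s e₁ e₂)
  refine (h.isGauss.cons_chord hy _ _).cons_chord ?_ _ _
  intro l hl
  simp only [List.mem_cons] at hl
  rcases hl with rfl | rfl | hl
  exacts [hxy.symm, hxy.symm, hx l hl]

theorem OnKnot.erase_bigon
    (h : OnKnot K (u ++ bigonSide x y o s e₁ ++ v ++ bigonSide x y (!o) s e₂ ++ t)) :
    OnKnot K (u ++ v ++ t) :=
  h.move_inv (h.isGauss.perm (perm_bigonSide u v t x y o s e₁ e₂)).of_cons_chord.of_cons_chord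
    (basedMove_bigonSide u v t x y o s e₁ e₂)

theorem OnKnot.unused_bigon
    (h : OnKnot K (u ++ bigonSide x y o s e₁ ++ v ++ bigonSide x y (!o) s e₂ ++ t)) :
    x ≠ y ∧ Unused x (u ++ v ++ t) ∧ Unused y (u ++ v ++ t) := by
  have h1 := h.isGauss.perm (perm_bigonSide u v t x y o s e₁ e₂)
  have h2 := h1.unused_of_cons_chord
  exact ⟨fun hxy => h2 _ (List.mem_cons_self ..) hxy.symm, fun l hl =>
    h2 l (List.mem_cons_of_mem _ (List.mem_cons_of_mem _ hl)),
    h1.of_cons_chord.unused_of_cons_chord⟩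

variable {A : Type*} [AddCommGroup A] (p : OrientedParity K A)

theorem OrientedParity.wordVal_erase_bigon {n : ℕ}
    (h : OnKnot K (u ++ bigonSide x y o s e₁ ++ v ++ bigonSide x y (!o) s e₂ ++ t))
    (hn : n ∈ (u ++ v ++ t).map Letter.label) :
    p.wordVal (u ++ bigonSide x y o s e₁ ++ v ++ bigonSide x y (!o) s e₂ ++ t) n =
      p.wordVal (u ++ v ++ t) n := by
  refine (p.wordVal_move h.erase_bigon h (basedMove_bigonSide u v t x y o s e₁ e₂) hn ?_).symm
  simp only [List.map_append, List.mem_append, Equiv.Perm.one_apply] at hn ⊢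
  tauto

theorem OrientedParity.wordVal_bigon_add
    (h : OnKnot K (u ++ bigonSide x y o s e₁ ++ v ++ bigonSide x y (!o) s e₂ ++ t)) :
    p.wordVal (u ++ bigonSide x y o s e₁ ++ v ++ bigonSide x y (!o) s e₂ ++ t) x +
      p.wordVal (u ++ bigonSide x y o s e₁ ++ v ++ bigonSide x y (!o) s e₂ ++ t) y = 0 := by
  cases e₁
  · have h' := isR2_bigonSide u v t y x o (!s) (!e₂)
    rw [← Bool.not_false, bigonSide_swap, bigonSide_swap] at h'
    rw [add_comm]
    exact p.wordVal_r2 h.erase_bigon h h'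
  · exact p.wordVal_r2 h.erase_bigon h (isR2_bigonSide u v t x y o s e₂)

end Insert

/-- The word with a bigon inserted in the arcs before `v` and before `v'`. The first strand is over
iff `o = true`, and crosses the second one from left to right at `x` iff `g = true`. -/
def bigonWord (x y : ℕ) (e₁ e₂ o g : Bool) (v v' : List Letter) : List Letter :=
  bigonSide x y o (o == g) e₁ ++ v ++ bigonSide x y (!o) (o == g) e₂ ++ v'

section Bigon

variable {K : Knot} {x y : ℕ} {e₁ e₂ o g : Bool} {v v' : List Letter}

theorem OnKnot.bigonWord (h : OnKnot K (v ++ v')) (hxy : x ≠ y) (hx : Unused x (v ++ v'))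
    (hy : Unused y (v ++ v')) : OnKnot K (bigonWord x y e₁ e₂ o g v v') :=
  OnKnot.insert_bigon (u := []) h hxy hx hy

theorem exists_perm_relabel {x y x' y' : ℕ} {w : List Letter} (hxy : x ≠ y) (hx : Unused x w)
    (hy : Unused y w) (hxy' : x' ≠ y') (hx' : Unused x' w) (hy' : Unused y' w) :
    ∃ σ : Equiv.Perm ℕ, σ x = x' ∧ σ y = y' ∧ w.map (Letter.relabel σ) = w := by
  have hne : Equiv.swap x x' y ≠ x' := fun h => hxy (by
    exact ((Equiv.swap x x').injective (h.trans (Equiv.swap_apply_left x x').symm)).symm)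
  refine ⟨Equiv.swap (Equiv.swap x x' y) y' * Equiv.swap x x', ?_, ?_, ?_⟩
  · rw [Equiv.Perm.mul_apply, Equiv.swap_apply_left,
      Equiv.swap_apply_of_ne_of_ne hne.symm hxy']
  · rw [Equiv.Perm.mul_apply, Equiv.swap_apply_left]
  · refine map_relabel_eq_self fun l hl => ?_
    have h1 : Equiv.swap x x' l.label = l.label :=
      Equiv.swap_apply_of_ne_of_ne (hx l hl) (hx' l hl)
    rw [Equiv.Perm.mul_apply, h1, Equiv.swap_apply_of_ne_of_ne ?_ (hy' l hl)]
    intro h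
    rw [h] at h1
    exact hy l hl (h.trans ((Equiv.swap x x').injective h1))

variable {A : Type*} [AddCommGroup A] (p : OrientedParity K A)

namespace OrientedParity

theorem wordVal_bigonWord_congr {x' y' : ℕ} (h : OnKnot K (bigonWord x y e₁ e₂ o g v v'))
    (hxy' : x' ≠ y') (hx' : Unused x' (v ++ v')) (hy' : Unused y' (v ++ v')) :
    p.wordVal (bigonWord x y e₁ e₂ o g v v') x =
      p.wordVal (bigonWord x' y' e₁ e₂ o g v v') x' := by
  obtain ⟨hxy, hx, hy⟩ := OnKnot.unused_bigon (u := []) h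
  obtain ⟨σ, rfl, rfl, hσ⟩ := exists_perm_relabel hxy hx hy hxy' hx' hy'
  have hvv : v.map (Letter.relabel σ) = v ∧ v'.map (Letter.relabel σ) = v' := by
    rw [List.nil_append, List.map_append] at hσ
    exact List.append_inj hσ (by simp)
  have hw : (bigonWord x y e₁ e₂ o g v v').map (Letter.relabel σ) =
      bigonWord (σ x) (σ y) e₁ e₂ o g v v' := by
    simp only [bigonWord, List.map_append, map_relabel_bigonSide, hvv.1, hvv.2]
  have h0 : OnKnot K (v ++ v') := OnKnot.erase_bigon (u := []) h
  refine p.wordVal_move h (h0.bigonWord hxy' hx' hy') (hw ▸ BasedMove.isotopy σ _) ?_ ?_ <;>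
  simp only [bigonWord, List.map_append, List.mem_append, mem_bigonSide, true_or]

/-- The parity of the vertex `x` of a bigon inserted in the arcs before `v` and before `v'` of the
diagram `v ++ v'`. -/
noncomputable def bigonVal (e₁ e₂ o g : Bool) (v v' : List Letter) : A :=
  p.wordVal (bigonWord (freshLabel (v ++ v')) (freshLabel (v ++ v') + 1) e₁ e₂ o g v v')
    (freshLabel (v ++ v'))

theorem wordVal_bigonWord (h : OnKnot K (bigonWord x y e₁ e₂ o g v v')) :
    p.wordVal (bigonWord x y e₁ e₂ o g v v') x = p.bigonVal e₁ e₂ o g v v' :=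
  p.wordVal_bigonWord_congr h (Nat.ne_add_one _) (unused_of_freshLabel_le le_rfl)
    (unused_of_freshLabel_le (Nat.le_succ _))

/-- The two vertices of the bigon are exchanged. -/
theorem bigonVal_not (h : OnKnot K (v ++ v')) :
    p.bigonVal (!e₁) (!e₂) o (!g) v v' = -p.bigonVal e₁ e₂ o g v v' := by
  set n := freshLabel (v ++ v')
  have hn : Unused n (v ++ v') := unused_of_freshLabel_le le_rfl
  have hn' : Unused (n + 1) (v ++ v') := unused_of_freshLabel_le (Nat.le_succ _)
  have hb : OnKnot K (bigonWord n (n + 1) e₁ e₂ o g v v') :=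
    h.bigonWord (Nat.ne_add_one n) hn hn'
  have hw : bigonWord (n + 1) n (!e₁) (!e₂) o (!g) v v' =
      bigonWord n (n + 1) e₁ e₂ o g v v' := by
    have : (o == !g) = !(o == g) := by cases o <;> cases g <;> rfl
    simp only [bigonWord, this, bigonSide_swap]
  rw [← p.wordVal_bigonWord hb, ← p.wordVal_bigonWord (hw ▸ hb), hw]
  exact eq_neg_of_add_eq_zero_right (p.wordVal_bigon_add (u := []) hb)

theorem bigonVal_rotate (h : OnKnot K (v ++ v')) :
    p.bigonVal e₂ e₁ (!o) (!g) v' v = p.bigonVal e₁ e₂ o g v v' := by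
  set n := freshLabel (v ++ v')
  have hn : Unused n (v ++ v') := unused_of_freshLabel_le le_rfl
  have hn' : Unused (n + 1) (v ++ v') := unused_of_freshLabel_le (Nat.le_succ _)
  have hb : OnKnot K (bigonWord n (n + 1) e₁ e₂ o g v v') :=
    h.bigonWord (Nat.ne_add_one n) hn hn'
  have hw : bigonWord n (n + 1) e₁ e₂ o g v v' = (bigonSide n (n + 1) o (o == g) e₁ ++ v) ++
      (bigonSide n (n + 1) (!o) (o == g) e₂ ++ v') := by
    simp only [bigonWord, List.append_assoc]
  have hw' : bigonWord n (n + 1) e₂ e₁ (!o) (!g) v' v =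
      (bigonSide n (n + 1) (!o) (o == g) e₂ ++ v') ++
        (bigonSide n (n + 1) o (o == g) e₁ ++ v) := by
    have : ((!o) == !g) = (o == g) := by cases o <;> cases g <;> rfl
    simp only [bigonWord, List.append_assoc, this, Bool.not_not]
  have hb' : OnKnot K (bigonWord n (n + 1) e₂ e₁ (!o) (!g) v' v) := by
    rw [hw']
    exact OnKnot.rotate (hw ▸ hb)
  rw [← p.wordVal_bigonWord hb, ← p.wordVal_bigonWord hb', hw, hw']
  refine p.wordVal_rotate (hw ▸ hb) ?_
  simp only [List.map_append, List.mem_append, mem_bigonSide, true_or]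

end OrientedParity

end Bigon

/-! ### Triangles -/

/-- A side of a triangle, prolonged beyond both of its vertices: `p` and `q` are the sides of the
bigons at the vertex where the side starts and at the vertex where it ends when one runs
counterclockwise around the triangle. The strand runs counterclockwise iff `d = true`. -/
def triangleSide (d : Bool) (p q : Bool → List Letter) : List Letter :=
  if d then p false ++ q true else q false ++ p true

theorem exists_triangleSide_eq_right (d : Bool) (p q : Bool → List Letter) :
    ∃ a b, triangleSide d p q = a ++ q d ++ b ∧ a ++ b = p (!d) := by
  cases d
  · exact ⟨[], p true, by simp [triangleSide], rfl⟩
  · exact ⟨p false, [], by simp [triangleSide], by simp⟩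

theorem exists_triangleSide_eq_left (d : Bool) (p q : Bool → List Letter) :
    ∃ a b, triangleSide d p q = a ++ p (!d) ++ b ∧ a ++ b = q d := by
  cases d
  · exact ⟨q false, [], by simp [triangleSide], by simp⟩
  · exact ⟨[], q true, by simp [triangleSide], rfl⟩

/-- Three strands in the arcs before `v₁`, `v₂`, `v₃` that form a triangle with the vertices `x`
(first and second strand), `y` (second and third), `z` (third and first), in this order
counterclockwise, together with bigons opposite to the triangle at each of its vertices; the second
vertices of the bigons are `x'`, `y'`, `z'`. The strand `i` runs counterclockwise around the
triangle iff `dᵢ = true`, and `oᵢⱼ = true` iff the strand `i` goes over the strand `j`. -/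
def triangleWord (x x' y y' z z' : ℕ) (d₁ d₂ d₃ o₁₂ o₂₃ o₃₁ : Bool) (v₁ v₂ v₃ : List Letter) :
    List Letter :=
  triangleSide d₁ (bigonSide z z' (!o₃₁) (o₃₁ == (d₃ == d₁)))
      (bigonSide x x' o₁₂ (o₁₂ == (d₁ == d₂))) ++ v₁ ++
    triangleSide d₂ (bigonSide x x' (!o₁₂) (o₁₂ == (d₁ == d₂)))
      (bigonSide y y' o₂₃ (o₂₃ == (d₂ == d₃))) ++ v₂ ++
    triangleSide d₃ (bigonSide y y' (!o₂₃) (o₂₃ == (d₂ == d₃)))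
      (bigonSide z z' o₃₁ (o₃₁ == (d₃ == d₁))) ++ v₃

section Triangle

variable {K : Knot} {x x' y y' z z' : ℕ} {d₁ d₂ d₃ o₁₂ o₂₃ o₃₁ : Bool} {v₁ v₂ v₃ : List Letter}

theorem OnKnot.triangleWord_rotate
    (h : OnKnot K (triangleWord x x' y y' z z' d₁ d₂ d₃ o₁₂ o₂₃ o₃₁ v₁ v₂ v₃)) :
    OnKnot K (triangleWord y y' z z' x x' d₂ d₃ d₁ o₂₃ o₃₁ o₁₂ v₂ v₃ v₁) := by
  unfold triangleWord at h ⊢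
  simp only [List.append_assoc] at h
  rw [← List.append_assoc] at h
  simpa only [List.append_assoc] using h.rotate

theorem OnKnot.triangleWord (h : OnKnot K (v₁ ++ v₂ ++ v₃))
    (hd : [x, x', y, y', z, z'].Nodup)
    (hu : ∀ n ∈ [x, x', y, y', z, z'], Unused n (v₁ ++ v₂ ++ v₃)) :
    OnKnot K (triangleWord x x' y y' z z' d₁ d₂ d₃ o₁₂ o₂₃ o₃₁ v₁ v₂ v₃) := by
  simp only [List.nodup_cons, List.mem_cons, List.not_mem_nil, or_false, not_or] at hd
  simp only [List.mem_cons, List.not_mem_nil, or_false, forall_eq_or_imp, forall_eq,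
    unused_append] at hu
  have h1 : OnKnot K ([] ++ bigonSide x x' o₁₂ (o₁₂ == (d₁ == d₂)) d₁ ++ v₁ ++
      bigonSide x x' (!o₁₂) (o₁₂ == (d₁ == d₂)) (!d₂) ++ (v₂ ++ v₃)) := by
    refine OnKnot.insert_bigon (by simpa using h) (by tauto) ?_ ?_ <;>
    · simp only [unused_append, List.nil_append]
      tauto
  obtain ⟨a, b, hab, hab'⟩ := exists_triangleSide_eq_right d₂
    (bigonSide x x' (!o₁₂) (o₁₂ == (d₁ == d₂))) (bigonSide y y' o₂₃ (o₂₃ == (d₂ == d₃)))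
  have h2 : OnKnot K ((bigonSide x x' o₁₂ (o₁₂ == (d₁ == d₂)) d₁ ++ v₁ ++ a) ++
      bigonSide y y' o₂₃ (o₂₃ == (d₂ == d₃)) d₂ ++ (b ++ v₂) ++
      bigonSide y y' (!o₂₃) (o₂₃ == (d₂ == d₃)) (!d₃) ++ v₃) := by
    have hun : ∀ n, n ≠ x → n ≠ x' → Unused n a ∧ Unused n b := fun n h1 h2 => by
      rw [← unused_append, hab']
      exact unused_bigonSide.mpr ⟨h1, h2⟩
    refine OnKnot.insert_bigon ?_ (by tauto) ?_ ?_
    · rw [← hab'] at h1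
      simpa using h1
    · have := hun y (by tauto) (by tauto)
      simp only [unused_append, unused_bigonSide]
      tauto
    · have := hun y' (by tauto) (by tauto)
      simp only [unused_append, unused_bigonSide]
      tauto
  obtain ⟨a₁, b₁, hab₁, hab₁'⟩ := exists_triangleSide_eq_left d₁
    (bigonSide z z' (!o₃₁) (o₃₁ == (d₃ == d₁))) (bigonSide x x' o₁₂ (o₁₂ == (d₁ == d₂)))
  obtain ⟨a₃, b₃, hab₃, hab₃'⟩ := exists_triangleSide_eq_right d₃
    (bigonSide y y' (!o₂₃) (o₂₃ == (d₂ == d₃))) (bigonSide z z' o₃₁ (o₃₁ == (d₃ == d₁)))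
  have h3 : OnKnot K (a₁ ++ bigonSide z z' (!o₃₁) (o₃₁ == (d₃ == d₁)) (!d₁) ++
      (b₁ ++ v₁ ++ a ++ bigonSide y y' o₂₃ (o₂₃ == (d₂ == d₃)) d₂ ++ b ++ v₂ ++ a₃) ++
      bigonSide z z' (!(!o₃₁)) (o₃₁ == (d₃ == d₁)) d₃ ++ (b₃ ++ v₃)) := by
    have hun : ∀ n, n ≠ x → n ≠ x' → Unused n a ∧ Unused n b := fun n h1 h2 => by
      rw [← unused_append, hab']
      exact unused_bigonSide.mpr ⟨h1, h2⟩
    have hun₁ : ∀ n, n ≠ x → n ≠ x' → Unused n a₁ ∧ Unused n b₁ := fun n h1 h2 => by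
      rw [← unused_append, hab₁']
      exact unused_bigonSide.mpr ⟨h1, h2⟩
    have hun₃ : ∀ n, n ≠ y → n ≠ y' → Unused n a₃ ∧ Unused n b₃ := fun n h1 h2 => by
      rw [← unused_append, hab₃']
      exact unused_bigonSide.mpr ⟨h1, h2⟩
    refine OnKnot.insert_bigon ?_ (by tauto) ?_ ?_
    · rw [← hab₁', ← hab₃'] at h2
      simpa using h2
    · have := hun z (by tauto) (by tauto)
      have := hun₁ z (by tauto) (by tauto)
      have := hun₃ z (by tauto) (by tauto)
      simp only [unused_append, unused_bigonSide]
      tauto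
    · have := hun z' (by tauto) (by tauto)
      have := hun₁ z' (by tauto) (by tauto)
      have := hun₃ z' (by tauto) (by tauto)
      simp only [unused_append, unused_bigonSide]
      tauto
  simpa [VirtualKnot.triangleWord, hab, hab₁, hab₃] using h3

variable {A : Type*} [AddCommGroup A] (p : OrientedParity K A)

/-- Erasing the bigons of the other two vertices leaves the bigon at the vertex `x`. -/
theorem OrientedParity.wordVal_triangleWord
    (h : OnKnot K (triangleWord x x' y y' z z' d₁ d₂ d₃ o₁₂ o₂₃ o₃₁ v₁ v₂ v₃)) :
    p.wordVal (triangleWord x x' y y' z z' d₁ d₂ d₃ o₁₂ o₂₃ o₃₁ v₁ v₂ v₃) x =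
      p.bigonVal d₁ (!d₂) o₁₂ (d₁ == d₂) v₁ (v₂ ++ v₃) := by
  obtain ⟨a, b, hab, hab'⟩ := exists_triangleSide_eq_right d₂
    (bigonSide x x' (!o₁₂) (o₁₂ == (d₁ == d₂))) (bigonSide y y' o₂₃ (o₂₃ == (d₂ == d₃)))
  obtain ⟨a₁, b₁, hab₁, hab₁'⟩ := exists_triangleSide_eq_left d₁
    (bigonSide z z' (!o₃₁) (o₃₁ == (d₃ == d₁))) (bigonSide x x' o₁₂ (o₁₂ == (d₁ == d₂)))
  obtain ⟨a₃, b₃, hab₃, hab₃'⟩ := exists_triangleSide_eq_right d₃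
    (bigonSide y y' (!o₂₃) (o₂₃ == (d₂ == d₃))) (bigonSide z z' o₃₁ (o₃₁ == (d₃ == d₁)))
  have e3 : VirtualKnot.triangleWord x x' y y' z z' d₁ d₂ d₃ o₁₂ o₂₃ o₃₁ v₁ v₂ v₃ =
      a₁ ++ bigonSide z z' (!o₃₁) (o₃₁ == (d₃ == d₁)) (!d₁) ++
      (b₁ ++ v₁ ++ a ++ bigonSide y y' o₂₃ (o₂₃ == (d₂ == d₃)) d₂ ++ b ++ v₂ ++ a₃) ++
      bigonSide z z' (!(!o₃₁)) (o₃₁ == (d₃ == d₁)) d₃ ++ (b₃ ++ v₃) := by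
    simp [VirtualKnot.triangleWord, hab, hab₁, hab₃]
  rw [e3] at h ⊢
  have e2 : a₁ ++ (b₁ ++ v₁ ++ a ++ bigonSide y y' o₂₃ (o₂₃ == (d₂ == d₃)) d₂ ++ b ++ v₂ ++ a₃) ++
      (b₃ ++ v₃) = (bigonSide x x' o₁₂ (o₁₂ == (d₁ == d₂)) d₁ ++ v₁ ++ a) ++
      bigonSide y y' o₂₃ (o₂₃ == (d₂ == d₃)) d₂ ++ (b ++ v₂) ++
      bigonSide y y' (!o₂₃) (o₂₃ == (d₂ == d₃)) (!d₃) ++ v₃ := by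
    rw [← hab₁', ← hab₃']
    simp
  have e1 : (bigonSide x x' o₁₂ (o₁₂ == (d₁ == d₂)) d₁ ++ v₁ ++ a) ++ (b ++ v₂) ++ v₃ =
      bigonWord x x' d₁ (!d₂) o₁₂ (d₁ == d₂) v₁ (v₂ ++ v₃) := by
    rw [bigonWord, ← hab']
    simp
  have h2 := h.erase_bigon
  rw [p.wordVal_erase_bigon h, e2, p.wordVal_erase_bigon (e2 ▸ h2), e1, p.wordVal_bigonWord]
  · rw [e2] at h2
    exact e1 ▸ h2.erase_bigon
  · simp only [List.map_append, List.mem_append, mem_bigonSide, true_or]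
  · rw [e2]
    simp only [List.map_append, List.mem_append, mem_bigonSide, true_or]

theorem OrientedParity.wordVal_triangleWord_rotate {n : ℕ}
    (h : OnKnot K (triangleWord x x' y y' z z' d₁ d₂ d₃ o₁₂ o₂₃ o₃₁ v₁ v₂ v₃))
    (hn : n ∈ (triangleWord x x' y y' z z' d₁ d₂ d₃ o₁₂ o₂₃ o₃₁ v₁ v₂ v₃).map Letter.label) :
    p.wordVal (triangleWord y y' z z' x x' d₂ d₃ d₁ o₂₃ o₃₁ o₁₂ v₂ v₃ v₁) n =
      p.wordVal (triangleWord x x' y y' z z' d₁ d₂ d₃ o₁₂ o₂₃ o₃₁ v₁ v₂ v₃) n := by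
  unfold VirtualKnot.triangleWord at h hn ⊢
  simp only [List.append_assoc] at h hn ⊢
  rw [← List.append_assoc] at h hn
  simpa only [List.append_assoc] using p.wordVal_rotate h hn

end Triangle

/-! ### The cocycle of the bigons -/

section Cocycle

variable {K : Knot} {v₁ v₂ v₃ : List Letter}

/-- The third Reidemeister move applies to the inner triangle of `triangleWord`. -/
theorem exists_isR3_triangleWord_true (x x' y y' z z' : ℕ) (d₁ d₂ d₃ : Bool)
    (v₁ v₂ v₃ : List Letter) :
    ∃ w', IsR3 x z y d₁ d₂ d₃
      (triangleWord x x' y y' z z' d₁ d₂ d₃ true true false v₁ v₂ v₃) w' := by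
  let core (d : Bool) (a b : Letter) : List Letter := if d then [a, b] else [b, a]
  let outer (d : Bool) (a b : Letter) : Letter := if d then b else a
  refine ⟨_, true, core d₁ ⟨z, true, !(d₃ == d₁)⟩ ⟨x, true, d₁ == d₂⟩,
    core d₂ ⟨x, false, d₁ == d₂⟩ ⟨y, true, true == (d₂ == d₃)⟩,
    core d₃ ⟨y, !true, true == (d₂ == d₃)⟩ ⟨z, false, !(d₃ == d₁)⟩,
    [outer d₁ ⟨x', true, !(d₁ == d₂)⟩ ⟨z', true, !!(d₃ == d₁)⟩],
    [outer d₁ ⟨z', true, !!(d₃ == d₁)⟩ ⟨x', true, !(d₁ == d₂)⟩] ++ v₁ ++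
      [outer d₂ ⟨y', true, !(true == (d₂ == d₃))⟩ ⟨x', false, !(d₁ == d₂)⟩],
    [outer d₂ ⟨x', false, !(d₁ == d₂)⟩ ⟨y', true, !(true == (d₂ == d₃))⟩] ++ v₂ ++
      [outer d₃ ⟨z', false, !!(d₃ == d₁)⟩ ⟨y', !true, !(true == (d₂ == d₃))⟩],
    [outer d₃ ⟨y', !true, !(true == (d₂ == d₃))⟩ ⟨z', false, !!(d₃ == d₁)⟩] ++ v₃, ?_, ?_, rfl⟩
  · cases d₁ <;> cases d₂ <;> cases d₃ <;> exact List.Perm.refl _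
  · cases d₁ <;> cases d₂ <;> cases d₃ <;>
      simp [triangleWord, triangleSide, bigonSide, core, outer]

/-- When the third strand is the middle one, the top, the middle and the bottom strand follow each
other in the opposite cyclic order, whence the opposite orientation and opposite directions. -/
theorem exists_isR3_triangleWord_false (x x' y y' z z' : ℕ) (d₁ d₂ d₃ : Bool)
    (v₁ v₂ v₃ : List Letter) :
    ∃ w', IsR3 z x y (!d₁) (!d₃) (!d₂)
      (triangleWord x x' y y' z z' d₁ d₂ d₃ true false false v₁ v₂ v₃) w' := by
  let core (d : Bool) (a b : Letter) : List Letter := if d then [a, b] else [b, a]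
  let outer (d : Bool) (a b : Letter) : Letter := if d then b else a
  refine ⟨_, false, core d₁ ⟨z, true, !(d₃ == d₁)⟩ ⟨x, true, d₁ == d₂⟩,
    core d₂ ⟨x, false, d₁ == d₂⟩ ⟨y, false, false == (d₂ == d₃)⟩,
    core d₃ ⟨y, !false, false == (d₂ == d₃)⟩ ⟨z, false, !(d₃ == d₁)⟩,
    [outer d₁ ⟨x', true, !(d₁ == d₂)⟩ ⟨z', true, !!(d₃ == d₁)⟩],
    [outer d₁ ⟨z', true, !!(d₃ == d₁)⟩ ⟨x', true, !(d₁ == d₂)⟩] ++ v₁ ++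
      [outer d₂ ⟨y', false, !(false == (d₂ == d₃))⟩ ⟨x', false, !(d₁ == d₂)⟩],
    [outer d₂ ⟨x', false, !(d₁ == d₂)⟩ ⟨y', false, !(false == (d₂ == d₃))⟩] ++ v₂ ++
      [outer d₃ ⟨z', false, !!(d₃ == d₁)⟩ ⟨y', !false, !(false == (d₂ == d₃))⟩],
    [outer d₃ ⟨y', !false, !(false == (d₂ == d₃))⟩ ⟨z', false, !!(d₃ == d₁)⟩] ++ v₃, ?_, ?_, rfl⟩
  · cases d₁ <;> cases d₂ <;> cases d₃ <;> exact (List.Perm.swap _ _ _).cons _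
  · cases d₁ <;> cases d₂ <;> cases d₃ <;>
      simp [triangleWord, triangleSide, bigonSide, core, outer]

theorem incidence_not (a b : Bool) : incidence (!a) (!b) = incidence a b := by
  cases a <;> cases b <;> rfl

theorem incidence_comm (a b : Bool) : incidence a b = incidence b a := by
  cases a <;> cases b <;> rfl

namespace OrientedParity

variable {A : Type*} [AddCommGroup A] (p : OrientedParity K A)

/-- The relation of a third Reidemeister move between three arcs whose first strand is the top
one. -/
theorem bigonVal_triangle (h : OnKnot K (v₁ ++ v₂ ++ v₃)) (d₁ d₂ d₃ o₂₃ : Bool) :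
    incidence d₁ d₂ • p.bigonVal d₁ (!d₂) true (d₁ == d₂) v₁ (v₂ ++ v₃) +
      incidence d₂ d₃ • p.bigonVal d₂ (!d₃) o₂₃ (d₂ == d₃) v₂ (v₃ ++ v₁) +
      incidence d₃ d₁ • p.bigonVal d₃ (!d₁) false (d₃ == d₁) v₃ (v₁ ++ v₂) = 0 := by
  set n := freshLabel (v₁ ++ v₂ ++ v₃) with hn
  have hT : OnKnot K (triangleWord n (n + 1) (n + 2) (n + 3) (n + 4) (n + 5) d₁ d₂ d₃ true o₂₃
      false v₁ v₂ v₃) := by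
    refine h.triangleWord (by simp) ?_
    simp only [List.mem_cons, List.not_mem_nil, or_false]
    rintro m (rfl | rfl | rfl | rfl | rfl | rfl) <;>
      exact unused_of_freshLabel_le (by omega)
  rw [← p.wordVal_triangleWord hT, ← p.wordVal_triangleWord hT.triangleWord_rotate,
    ← p.wordVal_triangleWord hT.triangleWord_rotate.triangleWord_rotate]
  have hmem : n + 2 ∈ (triangleWord n (n + 1) (n + 2) (n + 3) (n + 4) (n + 5) d₁ d₂ d₃ true o₂₃
      false v₁ v₂ v₃).map Letter.label ∧ n + 4 ∈ (triangleWord n (n + 1) (n + 2) (n + 3) (n + 4)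
      (n + 5) d₁ d₂ d₃ true o₂₃ false v₁ v₂ v₃).map Letter.label := by
    constructor
    · cases d₂ <;> simp [triangleWord, triangleSide, bigonSide]
    · cases d₁ <;> simp [triangleWord, triangleSide, bigonSide]
  have hmem' : n + 4 ∈ (triangleWord (n + 2) (n + 3) (n + 4) (n + 5) n (n + 1) d₂ d₃ d₁ o₂₃ false
      true v₂ v₃ v₁).map Letter.label := by
    cases d₁ <;> simp [triangleWord, triangleSide, bigonSide]
  rw [p.wordVal_triangleWord_rotate hT hmem.1,
    p.wordVal_triangleWord_rotate hT.triangleWord_rotate hmem',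
    p.wordVal_triangleWord_rotate hT hmem.2]
  cases o₂₃
  · obtain ⟨w', hR⟩ := exists_isR3_triangleWord_false n (n + 1) (n + 2) (n + 3) (n + 4) (n + 5)
      d₁ d₂ d₃ v₁ v₂ v₃
    have := p.wordVal_r3 hT hR
    rw [incidence_not, incidence_not, incidence_not] at this
    rw [← this, incidence_comm d₃ d₁, incidence_comm d₃ d₂]
    abel
  · obtain ⟨w', hR⟩ := exists_isR3_triangleWord_true n (n + 1) (n + 2) (n + 3) (n + 4) (n + 5)
      d₁ d₂ d₃ v₁ v₂ v₃
    have := p.wordVal_r3 hT hR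
    rw [← this, incidence_comm d₃ d₁]
    abel

/-- A bigon does not see which of its strands is the upper one: with a third strand on top, the
third Reidemeister move applies in both cases. -/
theorem bigonVal_over_eq {v v' : List Letter} (h : OnKnot K (v ++ v')) (e₁ e₂ o g : Bool) :
    p.bigonVal e₁ e₂ o g v v' = p.bigonVal e₁ e₂ true g v v' := by
  have aux : ∀ (e₁ e₂ o o' : Bool),
      p.bigonVal e₁ e₂ o (e₁ == !e₂) v v' = p.bigonVal e₁ e₂ o' (e₁ == !e₂) v v' := by
    intro e₁ e₂ o o'
    -- The top strand is put before `v'`, next to the second strand of the bigon; only the height of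
    -- the bigon differs in the two relations.
    have h1 := p.bigonVal_triangle (v₁ := v') (v₂ := v) (v₃ := [])
      (by simpa using h.rotate) true e₁ (!e₂) o
    have h2 := p.bigonVal_triangle (v₁ := v') (v₂ := v) (v₃ := [])
      (by simpa using h.rotate) true e₁ (!e₂) o'
    rw [← h2] at h1
    simp only [List.nil_append, Bool.not_not, add_left_inj, add_right_inj] at h1
    unfold incidence at h1
    split_ifs at h1
    · simpa using h1
    · simpa using h1
  -- The other value of `g` is reached by exchanging the vertices of the bigon.
  by_cases hg : g = (e₁ == !e₂)
  · rw [hg]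
    exact aux ..
  · have h3 := aux (!e₁) (!e₂) o true
    have hg' : ((!e₁) == !!e₂) = !g := by
      revert hg
      cases g <;> cases e₁ <;> cases e₂ <;> simp
    rw [hg', p.bigonVal_not h, p.bigonVal_not h] at h3
    exact neg_injective h3

/-- The difference of the potentials of two directed strands, in the arcs before `v` and before
`v'`: up to sign, the parity of the vertex of the bigon of these strands that would be the vertex
of a triangle around which they run counterclockwise (`dᵢ = true`) or clockwise. -/
noncomputable def strandDiff (d₁ d₂ : Bool) (v v' : List Letter) : A :=
  incidence d₁ d₂ • p.bigonVal d₁ (!d₂) true (d₁ == d₂) v v'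

theorem strandDiff_comm {v v' : List Letter} (h : OnKnot K (v ++ v')) (d₁ d₂ : Bool) :
    p.strandDiff d₂ d₁ v' v = -p.strandDiff d₁ d₂ v v' := by
  unfold strandDiff
  rw [← p.bigonVal_rotate h.rotate, Bool.not_true, p.bigonVal_over_eq h,
    incidence_comm d₂ d₁, ← smul_neg, ← p.bigonVal_not h, Bool.not_not, Bool.beq_comm (a := d₂)]

theorem strandDiff_add (h : OnKnot K (v₁ ++ v₂ ++ v₃)) (d₁ d₂ d₃ : Bool) :
    p.strandDiff d₁ d₂ v₁ (v₂ ++ v₃) + p.strandDiff d₂ d₃ v₂ (v₃ ++ v₁) =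
      p.strandDiff d₁ d₃ (v₁ ++ v₂) v₃ := by
  have h1 := p.bigonVal_triangle h d₁ d₂ d₃ true
  rw [p.bigonVal_over_eq h.rotate] at h1
  rw [← neg_neg (p.strandDiff d₁ d₃ _ _), ← p.strandDiff_comm h]
  exact eq_neg_of_add_eq_zero_left h1

/-- The bigon of two antiparallel strands in the same arc disappears in two first Reidemeister
moves. -/
theorem strandDiff_self {w : List Letter} (h : OnKnot K w) (d : Bool) :
    p.strandDiff d d [] w = 0 := by
  set n := freshLabel w
  have hn : Unused n w := unused_of_freshLabel_le le_rfl
  have hn' : Unused (n + 1) w := unused_of_freshLabel_le (Nat.le_succ _)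
  have hb : ∀ e₁ e₂ o g, OnKnot K (bigonWord n (n + 1) e₁ e₂ o g [] w) := fun _ _ _ _ =>
    h.bigonWord (v := []) (Nat.ne_add_one n) hn hn'
  have hkink : ∀ m s, Unused m w → OnKnot K ([⟨m, true, s⟩, ⟨m, false, s⟩] ++ w) := fun m s hm =>
    h.move (h.isGauss.cons_chord hm true s) (.r1 ⟨true, s, [], w, rfl, rfl⟩)
  rw [strandDiff, ← p.wordVal_bigonWord (hb ..)]
  refine smul_eq_zero_of_right _ ?_
  cases d
  · exact p.wordVal_r1 (hkink (n + 1) false hn') (hb ..)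
      ⟨true, true, [⟨n + 1, true, false⟩], [⟨n + 1, false, false⟩] ++ w, rfl, rfl⟩
  · have h0 : p.wordVal (bigonWord n (n + 1) true false true true [] w) (n + 1) = 0 :=
      p.wordVal_r1 (hkink n true hn) (hb ..)
        ⟨true, false, [⟨n, true, true⟩], [⟨n, false, true⟩] ++ w, rfl, rfl⟩
    have h1 : p.wordVal (bigonWord n (n + 1) true false true true [] w) n +
        p.wordVal (bigonWord n (n + 1) true false true true [] w) (n + 1) = 0 :=
      p.wordVal_bigon_add (u := []) (v := []) (t := w) (o := true) (s := true) (e₁ := true)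
        (e₂ := false) (hb true false true true)
    rwa [h0, add_zero] at h1

end OrientedParity

end Cocycle

/-! ### Potentials of the arcs -/

namespace OrientedParity

variable {K : Knot} {A : Type*} [AddCommGroup A] (p : OrientedParity K A)
  {u v t w w' : List Letter}

theorem strandDiff_antisymm (h : OnKnot K w) (d₁ d₂ : Bool) :
    p.strandDiff d₁ d₂ [] w = -p.strandDiff d₂ d₁ [] w := by
  have h1 := p.strandDiff_add (v₁ := []) (v₂ := []) (v₃ := w) h d₁ d₂ d₁
  simp only [List.nil_append, List.append_nil, p.strandDiff_self h] at h1
  exact eq_neg_of_add_eq_zero_left h1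

/-- The parity of the first crossing of a bigon of an arc with itself does not depend on which of
the strands is on the left. -/
theorem bigonVal_self (h : OnKnot K w) (g : Bool) :
    p.bigonVal true true true g [] w = -p.strandDiff true false [] w := by
  cases g
  · simp [strandDiff, incidence]
  · rw [← p.strandDiff_antisymm h, strandDiff, ← neg_neg (p.bigonVal true true true true [] w),
      ← p.bigonVal_not (v := []) h]
    simp [incidence]

/-- The potential of a strand in the direction `d` (in the sense of `strandDiff`) in the arc before
the letter number `i`, relative to the strand in the direction `true` in the arc `0`. -/
noncomputable def strandPotential (w : List Letter) (d : Bool) (i : ℕ) : A :=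
  p.strandDiff true d (w.take i) (w.drop i)

theorem strandPotential_length (h : OnKnot K w) (d : Bool) :
    p.strandPotential w d w.length = p.strandPotential w d 0 := by
  simp only [strandPotential, List.take_length, List.drop_length, List.take_zero, List.drop_zero]
  rw [p.strandDiff_comm (v := []) h, ← p.strandDiff_antisymm h]

theorem strandDiff_eq_sub (h : OnKnot K (u ++ v ++ t)) (d₁ d₂ : Bool) :
    p.strandDiff d₁ d₂ v (t ++ u) = p.strandPotential (u ++ v ++ t) d₂ (u.length + v.length) -
      p.strandPotential (u ++ v ++ t) d₁ u.length := by
  rw [eq_sub_iff_add_eq']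
  have := p.strandDiff_add h true d₁ d₂
  rw [strandPotential, strandPotential, ← List.length_append, List.take_left, List.drop_left,
    List.append_assoc, List.take_left, List.drop_left]
  exact this

theorem selfParity_eq_bigonVal (D : Diagram K) (i : D.1.Arc) (o s : Bool) :
    p.selfParity D i o s = p.bigonVal true true true (o == s) [] (D.1.based i) := by
  have hw : (D.selfR2 i o s).1.word =
      bigonWord D.1.fresh (D.1.fresh + 1) true true o (o == s) [] (D.1.based i) := by
    have : (o == (o == s)) = s := by cases o <;> cases s <;> rfl
    rw [bigonWord, this]
    rfl
  rw [selfParity, val_eq_wordVal, hw, p.wordVal_bigonWord, p.bigonVal_over_eq (v := [])]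
  · exact OnKnot.based D i
  · exact ⟨_, hw⟩

theorem selfParity_eq (D : Diagram K) (i : D.1.Arc) (o s : Bool) :
    p.selfParity D i o s = -p.strandDiff true false [] (D.1.based i) := by
  rw [selfParity_eq_bigonVal, p.bigonVal_self (OnKnot.based D i)]

theorem potential_eq_sub (D : Diagram K) (i : D.1.Arc) :
    p.potential D i =
      p.strandPotential D.1.word true i - p.strandPotential D.1.word false i := by
  have hb : D.1.based i = D.1.word.drop i ++ D.1.word.take i := by
    rcases D.1.word.eq_nil_or_concat' with hn | ⟨L, b, hL⟩
    · simp [GaussDiagram.based, hn]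
    · refine List.rotate_eq_drop_append_take ?_
      have h1 := i.2
      have h2 : 0 < D.1.word.length := by simp [hL]
      unfold GaussDiagram.arcCount at h1
      omega
  have h : OnKnot K (D.1.word.take i ++ D.1.word.drop i) := ⟨D, by simp⟩
  have h1 := p.strandDiff_add (v₁ := D.1.word.take i) (v₂ := []) (v₃ := D.1.word.drop i)
    (by simpa using h) true true false
  simp only [List.nil_append, List.append_nil] at h1
  rw [potential, selfParity_eq, hb, strandPotential, strandPotential, ← h1]
  abel

end OrientedParity

/-! ### Invariance of the potentials -/

section Invariance

variable {K : Knot} {A : Type*} [AddCommGroup A] (p : OrientedParity K A) {w w' : List Letter}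

theorem BasedMove.append_left {σ : Equiv.Perm ℕ} (h : BasedMove σ w w') (u : List Letter) :
    BasedMove σ (u ++ w) (u.map (Letter.relabel σ) ++ w') := by
  cases h with
  | isotopy =>
    rw [← List.map_append]
    exact .isotopy σ _
  | @r1 x _ _ h =>
    obtain ⟨o, s, u₁, v, rfl, rfl⟩ := h
    rw [map_relabel_one]
    exact .r1 (x := x) ⟨o, s, u ++ u₁, v, by simp, by simp⟩
  | @r2 x y _ _ h =>
    obtain ⟨o, s, d, u₁, v, t, rfl, rfl⟩ := h
    rw [map_relabel_one]
    exact .r2 (x := x) (y := y) ⟨o, s, d, u ++ u₁, v, t, by simp, by simp⟩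
  | r3 h =>
    obtain ⟨κ, c₁, c₂, c₃, u₀, u₁, u₂, u₃, hp, rfl, rfl⟩ := h
    rw [map_relabel_one]
    exact .r3 ⟨κ, c₁, c₂, c₃, u ++ u₀, u₁, u₂, u₃, hp, by simp, by simp⟩

/-- A move outside of the base point can be made in the presence of a bigon at the base point. -/
theorem OrientedParity.bigonVal_move (h : OnKnot K w) (h' : OnKnot K w') {σ : Equiv.Perm ℕ}
    (hm : BasedMove σ w w') (e₁ e₂ o g : Bool) :
    p.bigonVal e₁ e₂ o g [] w = p.bigonVal e₁ e₂ o g [] w' := by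
  set n := freshLabel (w ++ w'.map (Letter.relabel σ⁻¹))
  have hun : ∀ x, n ≤ x → Unused x w ∧ Unused (σ x) w' := by
    intro x hx
    obtain ⟨h1, h2⟩ := unused_append.mp (unused_of_freshLabel_le hx)
    refine ⟨h1, fun l hl hlx => h2 _ (List.mem_map_of_mem hl) ?_⟩
    simp [Letter.relabel, hlx]
  have hb : OnKnot K (bigonWord n (n + 1) e₁ e₂ o g [] w) :=
    h.bigonWord (v := []) (Nat.ne_add_one n) (hun n le_rfl).1 (hun _ (Nat.le_succ n)).1
  have hb' : OnKnot K (bigonWord (σ n) (σ (n + 1)) e₁ e₂ o g [] w') :=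
    h'.bigonWord (v := []) (σ.injective.ne (Nat.ne_add_one n)) (hun n le_rfl).2
      (hun _ (Nat.le_succ n)).2
  rw [← p.wordVal_bigonWord hb, ← p.wordVal_bigonWord hb']
  refine p.wordVal_move hb hb' ?_ ?_ ?_
  · have := hm.append_left (bigonWord n (n + 1) e₁ e₂ o g [] [])
    simpa only [bigonWord, List.map_append, List.append_nil, map_relabel_bigonSide,
      List.append_assoc, List.nil_append, List.map_nil] using this
  · simp only [bigonWord, List.map_append, List.mem_append, mem_bigonSide, true_or]
  · simp only [bigonWord, List.map_append, List.mem_append, mem_bigonSide, true_or]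

theorem OrientedParity.isInvariant_parityCycle : IsInvariant p.parityCycle := by
  intro D D' i i' σ hm
  simp only [parityCycle, potential, selfParity_eq_bigonVal]
  exact p.bigonVal_move (OnKnot.based D i) (OnKnot.based D' i') hm _ _ _ _

end Invariance

/-! ### The parity of a crossing as a difference of potentials -/

section Crossing

/-- The list with the only element `l`, or the empty list. -/
def optLetter (b : Bool) (l : Letter) : List Letter := if b then [l] else []

theorem optLetter_append_not (b : Bool) (l : Letter) :
    optLetter b l ++ optLetter (!b) l = [l] := by
  cases b <;> rfl

theorem length_optLetter (b : Bool) (l : Letter) : (optLetter b l).length = b.toNat := by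
  cases b <;> rfl

/-- Next to a passage through the crossing `n`, the bigon side with the vertices `x` and `y` can be
read as a bigon side with the vertices `n` and `x`. -/
theorem optLetter_append_bigonSide (n x y : ℕ) (o s e : Bool) :
    optLetter e ⟨n, o, s⟩ ++ bigonSide x y o (!s) e ++ optLetter (!e) ⟨n, o, s⟩ =
      optLetter (!e) ⟨y, o, s⟩ ++ bigonSide n x o s e ++ optLetter e ⟨y, o, s⟩ := by
  cases e <;> simp [optLetter, bigonSide]

variable {K : Knot} {A : Type*} [AddCommGroup A] (p : OrientedParity K A)

namespace OrientedParity

/-- A bigon of the two strands of a crossing is inserted next to this crossing, after (`eᵢ = true`)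
or before it on the strands. The crossing and the vertex of the bigon next to it are then the
vertices of another bigon, and their parities are opposite. -/
theorem wordVal_eq_neg_bigonVal {U V W : List Letter} {n : ℕ} {o s : Bool}
    (h : OnKnot K (U ++ [⟨n, o, s⟩] ++ V ++ [⟨n, !o, s⟩] ++ W)) (e₁ e₂ : Bool) :
    p.wordVal (U ++ [⟨n, o, s⟩] ++ V ++ [⟨n, !o, s⟩] ++ W) n =
      -p.bigonVal e₁ e₂ o (!(o == s))
        (optLetter (!e₁) ⟨n, o, s⟩ ++ V ++ optLetter e₂ ⟨n, !o, s⟩)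
        ((optLetter (!e₂) ⟨n, !o, s⟩ ++ W) ++ (U ++ optLetter e₁ ⟨n, o, s⟩)) := by
  set w := U ++ [⟨n, o, s⟩] ++ V ++ [⟨n, !o, s⟩] ++ W with hw
  set u := U ++ optLetter e₁ ⟨n, o, s⟩ with hu
  set v := optLetter (!e₁) ⟨n, o, s⟩ ++ V ++ optLetter e₂ ⟨n, !o, s⟩ with hv
  set t := optLetter (!e₂) ⟨n, !o, s⟩ ++ W with ht
  have hwe : w = u ++ v ++ t := by
    rw [hw, ← optLetter_append_not e₁, ← optLetter_append_not e₂, hu, hv, ht]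
    simp only [List.append_assoc]
  set x := freshLabel w
  have hx : Unused x w := unused_of_freshLabel_le le_rfl
  have hy : Unused (x + 1) w := unused_of_freshLabel_le (Nat.le_succ _)
  rw [hwe] at h hx hy
  have hb : OnKnot K (u ++ bigonSide x (x + 1) o (!s) e₁ ++ v ++
      bigonSide x (x + 1) (!o) (!s) e₂ ++ t) := h.insert_bigon (Nat.ne_add_one x) hx hy
  have hn : n ∈ (u ++ v ++ t).map Letter.label := by simp [← hwe, hw]
  have hb' : u ++ bigonSide x (x + 1) o (!s) e₁ ++ v ++ bigonSide x (x + 1) (!o) (!s) e₂ ++ t =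
      (U ++ optLetter (!e₁) ⟨x + 1, o, s⟩) ++ bigonSide n x o s e₁ ++
      (optLetter e₁ ⟨x + 1, o, s⟩ ++ V ++ optLetter (!e₂) ⟨x + 1, !o, s⟩) ++
      bigonSide n x (!o) s e₂ ++ (optLetter e₂ ⟨x + 1, !o, s⟩ ++ W) := by
    have h1 := optLetter_append_bigonSide n x (x + 1) o s e₁
    have h2 := optLetter_append_bigonSide n x (x + 1) (!o) s e₂
    calc _ = U ++ (optLetter e₁ ⟨n, o, s⟩ ++ bigonSide x (x + 1) o (!s) e₁ ++
          optLetter (!e₁) ⟨n, o, s⟩) ++ V ++ (optLetter e₂ ⟨n, !o, s⟩ ++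
          bigonSide x (x + 1) (!o) (!s) e₂ ++ optLetter (!e₂) ⟨n, !o, s⟩) ++ W := by
            rw [hu, hv, ht]
            simp only [List.append_assoc]
      _ = _ := by
            rw [h1, h2]
            simp only [List.append_assoc]
  have hword : bigonWord x (x + 1) e₁ e₂ o (!(o == s)) v (t ++ u) =
      (bigonSide x (x + 1) o (!s) e₁ ++ v ++ bigonSide x (x + 1) (!o) (!s) e₂ ++ t) ++ u := by
    have : (o == !(o == s)) = !s := by cases o <;> cases s <;> rfl
    rw [bigonWord, this]
    simp only [List.append_assoc]
  have hb2 : OnKnot K (u ++ (bigonSide x (x + 1) o (!s) e₁ ++ v ++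
      bigonSide x (x + 1) (!o) (!s) e₂ ++ t)) := by
    simpa only [List.append_assoc] using hb
  rw [← p.wordVal_bigonWord (x := x) (y := x + 1) (hword ▸ hb2.rotate), hword,
    p.wordVal_rotate hb2, hwe, ← p.wordVal_erase_bigon hb hn]
  · rw [hb'] at hb ⊢
    have hadd := p.wordVal_bigon_add hb
    rw [← hb'] at hadd ⊢
    rw [eq_neg_of_add_eq_zero_left hadd]
    simp only [List.append_assoc]
  · simp only [List.map_append, List.mem_append, mem_bigonSide, true_or, or_true]

theorem wordVal_eq_strandPotential_sub {U V W : List Letter} {l : Letter} {w : List Letter}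
    (hw : w = U ++ [l] ++ V ++ [l.swap] ++ W) (h : OnKnot K w) (e₁ e₂ : Bool) :
    p.wordVal w l.label =
      if l.goesRight then
        p.strandPotential w (!e₁) (U.length + 1 + V.length + e₂.toNat) -
          p.strandPotential w e₂ (U.length + e₁.toNat)
      else
        p.strandPotential w (!e₂) (U.length + e₁.toNat) -
          p.strandPotential w e₁ (U.length + 1 + V.length + e₂.toNat) := by
  obtain ⟨n, o, s⟩ := l
  set u := U ++ optLetter e₁ ⟨n, o, s⟩ with hu
  set v := optLetter (!e₁) ⟨n, o, s⟩ ++ V ++ optLetter e₂ ⟨n, !o, s⟩ with hv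
  set t := optLetter (!e₂) ⟨n, !o, s⟩ ++ W with ht
  have hwe : w = u ++ v ++ t := by
    rw [hw, ← optLetter_append_not e₁, Letter.swap, ← optLetter_append_not e₂, hu, hv, ht]
    simp only [List.append_assoc]
  have hval : p.wordVal w n = -p.bigonVal e₁ e₂ o (!(o == s)) v (t ++ u) := by
    have := p.wordVal_eq_neg_bigonVal (U := U) (V := V) (W := W) (n := n) (o := o) (s := s)
      (hw ▸ h) e₁ e₂
    rw [hw]
    exact this
  have huv : OnKnot K (v ++ (t ++ u)) := by
    have h1 : OnKnot K (u ++ (v ++ t)) := by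
      rw [← List.append_assoc, ← hwe]
      exact h
    simpa only [List.append_assoc] using h1.rotate
  have hlu : u.length = U.length + e₁.toNat := by
    rw [hu, List.length_append, length_optLetter]
  have hluv : u.length + v.length = U.length + 1 + V.length + e₂.toNat := by
    rw [hlu, hv, List.length_append, List.length_append, length_optLetter, length_optLetter]
    cases e₁ <;> simp <;> omega
  have hsub : ∀ d₁ d₂, p.strandDiff d₁ d₂ v (t ++ u) =
      p.strandPotential w d₂ (U.length + 1 + V.length + e₂.toNat) -
      p.strandPotential w d₁ (U.length + e₁.toNat) := fun d₁ d₂ => by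
    rw [p.strandDiff_eq_sub (hwe ▸ h), hluv, hlu, ← hwe]
  have hnot : ∀ e₁ e₂ g, p.bigonVal (!e₁) (!e₂) true (!g) v (t ++ u) =
    -p.bigonVal e₁ e₂ true g v (t ++ u) := fun _ _ _ => p.bigonVal_not huv
  rw [hval, p.bigonVal_over_eq huv]
  have hr : (⟨n, o, s⟩ : Letter).goesRight = (o == s) := rfl
  rcases Bool.eq_false_or_eq_true (o == s) with hg | hg
  · rw [hr, hg, if_pos rfl, ← hsub, strandDiff]
    have hnot' := hnot e₁ e₂ false
    cases e₁ <;> cases e₂ <;> simp [incidence] at hnot' ⊢ <;> exact hnot'.symm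
  · rw [hr, hg, if_neg Bool.false_ne_true, ← neg_sub, ← hsub, strandDiff]
    have hnot' := hnot e₁ e₂ true
    cases e₁ <;> cases e₂ <;> simp [incidence] at hnot' ⊢ <;> simp [hnot']

end OrientedParity

end Crossing

/-! ### Positions of the crossings -/

theorem Letter.goesRight_swap (l : Letter) :
    l.swap.goesRight = !l.goesRight := by
  obtain ⟨n, o, s⟩ := l
  cases o <;> cases s <;> rfl

namespace GaussDiagram

variable (D : GaussDiagram)

theorem exists_mem_of_crossing (v : D.Crossing) (r : Bool) :
    ∃ l ∈ D.word, l.label = v.1 ∧ l.goesRight = r := by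
  obtain ⟨l, hl, hv⟩ := List.mem_map.mp (mem_labels.mp v.2)
  by_cases hr : l.goesRight = r
  · exact ⟨l, hl, hv, hr⟩
  · refine ⟨l.swap, D.partner l hl, hv, ?_⟩
    rw [Letter.goesRight_swap]
    exact (Bool.not_eq.mpr hr)

theorem pos_lt (v : D.Crossing) (r : Bool) : D.pos v r < D.word.length := by
  obtain ⟨l, hl, hv, hr⟩ := D.exists_mem_of_crossing v r
  exact List.findIdx_lt_length_of_exists ⟨l, hl, by simp [hv, hr]⟩

theorem getElem_pos (v : D.Crossing) (r : Bool) :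
    (D.word[D.pos v r]'(D.pos_lt v r)).label = v.1 ∧
      (D.word[D.pos v r]'(D.pos_lt v r)).goesRight = r := by
  have h := List.findIdx_getElem (w := D.pos_lt v r)
  rw [Bool.and_eq_true, beq_iff_eq, beq_iff_eq] at h
  exact h

theorem eq_of_label_eq {l l' : Letter} (hl : l ∈ D.word) (hl' : l' ∈ D.word)
    (h : l.label = l'.label) (hr : l.goesRight = l'.goesRight) : l = l' := by
  have hp := D.coherent l hl l' hl' h
  obtain ⟨n, o, s⟩ := l
  obtain ⟨n', o', s'⟩ := l'
  simp only [Letter.goesRight] at hp h hr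
  subst hp h
  revert hr
  cases o <;> cases o' <;> cases s <;> simp

theorem swap_getElem_pos (v : D.Crossing) (r : Bool) :
    (D.word[D.pos v r]'(D.pos_lt v r)).swap = D.word[D.pos v (!r)]'(D.pos_lt v (!r)) := by
  refine D.eq_of_label_eq (D.partner _ (List.getElem_mem _)) (List.getElem_mem _) ?_ ?_
  · exact (D.getElem_pos v r).1.trans (D.getElem_pos v (!r)).1.symm
  · rw [Letter.goesRight_swap, (D.getElem_pos v r).2, (D.getElem_pos v (!r)).2]

theorem pos_inj {v v' : D.Crossing} {r r' : Bool} (h : D.pos v r = D.pos v' r') :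
    v = v' ∧ r = r' := by
  have h1 := D.getElem_pos v r
  have h2 := D.getElem_pos v' r'
  simp only [h] at h1
  exact ⟨Subtype.ext (h1.1.symm.trans h2.1), h1.2.symm.trans h2.2⟩

theorem exists_pos_eq {k : ℕ} (hk : k < D.word.length) : ∃ v r, D.pos v r = k := by
  have hv : D.word[k].label ∈ D.labels :=
    mem_labels.mpr (List.mem_map_of_mem (List.getElem_mem _))
  refine ⟨⟨_, hv⟩, D.word[k].goesRight, ?_⟩
  refine (D.nodup.getElem_inj_iff (hi := D.pos_lt _ _) (hj := hk)).mp ?_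
  obtain ⟨h1, h2⟩ := D.getElem_pos ⟨_, hv⟩ D.word[k].goesRight
  exact D.eq_of_label_eq (List.getElem_mem _) (List.getElem_mem _) h1 h2

/-- The passages through the crossings are the letters of the word. -/
theorem sum_pos {M : Type*} [AddCommMonoid M] (f : ℕ → M) :
    ∑ v : D.Crossing, (f (D.pos v true) + f (D.pos v false)) =
      ∑ k ∈ Finset.range D.word.length, f k := by
  have h1 : ∀ v : D.Crossing, f (D.pos v true) + f (D.pos v false) =
      ∑ r : Bool, f (D.pos v r) := fun v => by simp
  rw [Finset.sum_congr rfl fun v _ => h1 v, ← Fintype.sum_prod_type', ← Fin.sum_univ_eq_sum_range]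
  refine Fintype.sum_bijective (fun x => ⟨D.pos x.1 x.2, D.pos_lt x.1 x.2⟩) ⟨?_, ?_⟩ _ _
    fun _ => rfl
  · rintro ⟨v, r⟩ ⟨v', r'⟩ h
    obtain ⟨h1, h2⟩ := D.pos_inj (Fin.mk.inj h)
    exact Prod.ext h1 h2
  · rintro ⟨k, hk⟩
    obtain ⟨v, r, h⟩ := D.exists_pos_eq hk
    exact ⟨(v, r), Fin.ext h⟩

theorem inArc_val (v : D.Crossing) (r : Bool) : (D.inArc v r).val = D.pos v r := by
  have := D.pos_lt v r
  rw [inArc, Fin.val_ofNat, arcCount, max_eq_right (by omega)]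
  exact Nat.mod_eq_of_lt this

theorem outArc_val (v : D.Crossing) (r : Bool) :
    (D.outArc v r).val = if D.pos v r + 1 = D.word.length then 0 else D.pos v r + 1 := by
  have := D.pos_lt v r
  rw [outArc, Fin.val_ofNat, arcCount, max_eq_right (by omega)]
  split_ifs with h
  · rw [h, Nat.mod_self]
  · exact Nat.mod_eq_of_lt (by omega)

end GaussDiagram

theorem exists_eq_append_of_lt {α : Type*} {w : List α} {i j : ℕ} (hij : i < j)
    (hj : j < w.length) :
    ∃ U V W : List α, w = U ++ [w[i]] ++ V ++ [w[j]] ++ W ∧ U.length = i ∧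
      U.length + 1 + V.length = j := by
  refine ⟨w.take i, (w.drop (i + 1)).take (j - (i + 1)), w.drop (j + 1), ?_, ?_, ?_⟩
  · have h1 : w = w.take i ++ w.drop i := (List.take_append_drop i w).symm
    have h2 : w.drop (i + 1) = (w.drop (i + 1)).take (j - (i + 1)) ++ w.drop j := by
      conv_lhs => rw [← List.take_append_drop (j - (i + 1)) (w.drop (i + 1))]
      rw [List.drop_drop, Nat.add_sub_cancel' hij]
    conv_lhs => rw [h1, List.drop_eq_getElem_cons (hij.trans hj), h2,
      List.drop_eq_getElem_cons hj]
    simp only [List.append_assoc, List.nil_append, List.cons_append]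
  · simp; omega
  · simp; omega

/-! ### The intersection formula -/

namespace OrientedParity

variable {K : Knot} {A : Type*} [AddCommGroup A] (p : OrientedParity K A) (D : Diagram K)

/-- The parity of a crossing is a difference of strand potentials, in four ways: next to the
crossing the two strands are taken after (`e = true`) or before it. -/
theorem val_eq_strandPotential_sub (v : D.1.Crossing) (e₁ e₂ : Bool) :
    p.val D v = p.strandPotential D.1.word (!e₁) (D.1.pos v false + e₂.toNat) -
      p.strandPotential D.1.word e₂ (D.1.pos v true + e₁.toNat) := by
  rw [val_eq_wordVal]
  have hne : D.1.pos v true ≠ D.1.pos v false := fun h => by simpa using (D.1.pos_inj h).2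
  rcases lt_or_gt_of_ne hne with hlt | hlt
  · obtain ⟨U, V, W, hw, hU, hV⟩ := exists_eq_append_of_lt hlt (D.1.pos_lt v false)
    have hs := D.1.swap_getElem_pos v true
    simp only [Bool.not_true] at hs
    rw [← hs] at hw
    have := p.wordVal_eq_strandPotential_sub hw ⟨D, rfl⟩ e₁ e₂
    rwa [(D.1.getElem_pos v true).1, (D.1.getElem_pos v true).2, if_pos rfl, hV, hU] at this
  · obtain ⟨U, V, W, hw, hU, hV⟩ := exists_eq_append_of_lt hlt (D.1.pos_lt v true)
    have hs := D.1.swap_getElem_pos v false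
    simp only [Bool.not_false] at hs
    rw [← hs] at hw
    have := p.wordVal_eq_strandPotential_sub hw ⟨D, rfl⟩ e₂ e₁
    rwa [(D.1.getElem_pos v false).1, (D.1.getElem_pos v false).2, if_neg (by simp), hV, hU]
      at this

theorem parityCycle_inArc (v : D.1.Crossing) (r : Bool) :
    p.parityCycle D (D.1.inArc v r) = p.strandPotential D.1.word true (D.1.pos v r) -
      p.strandPotential D.1.word false (D.1.pos v r) := by
  rw [parityCycle, potential_eq_sub, D.1.inArc_val]

theorem parityCycle_outArc (v : D.1.Crossing) (r : Bool) :
    p.parityCycle D (D.1.outArc v r) = p.strandPotential D.1.word true (D.1.pos v r + 1) -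
      p.strandPotential D.1.word false (D.1.pos v r + 1) := by
  rw [parityCycle, potential_eq_sub, D.1.outArc_val]
  split_ifs with h
  · rw [h, p.strandPotential_length ⟨D, rfl⟩, p.strandPotential_length ⟨D, rfl⟩]
  · rfl

theorem boundary_parityCycle : D.1.boundary (p.parityCycle D) = 0 := by
  funext v
  have htt := p.val_eq_strandPotential_sub D v true true
  have hff := p.val_eq_strandPotential_sub D v false false
  have htf := p.val_eq_strandPotential_sub D v true false
  have hft := p.val_eq_strandPotential_sub D v false true
  simp only [Bool.not_true, Bool.not_false, Bool.toNat_true, Bool.toNat_false, add_zero]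
    at htt hff htf hft
  simp only [GaussDiagram.boundary, Fintype.sum_bool, parityCycle_inArc, parityCycle_outArc,
    Pi.zero_apply]
  -- Each of the four expressions for the parity of `v` occurs once.
  have key : (p.val D v - p.val D v) + (p.val D v - p.val D v) = 0 := by simp
  nth_rewrite 1 [htt] at key
  nth_rewrite 1 [hft] at key
  nth_rewrite 1 [hff] at key
  nth_rewrite 1 [htf] at key
  rw [← key]
  abel

/-- The intersection number of a cycle with the parity cycle is the sum of the differences of the
strand potential over the passages that the cycle, shifted to the left, makes at the crossings. -/
theorem intersection_parityCycle (α : D.1.Chain1 ℤ) (c : ℕ → ℤ)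
    (hout : ∀ v, α (D.1.outArc v true) = c (D.1.pos v true))
    (hin : ∀ v, α (D.1.inArc v false) = c (D.1.pos v false)) :
    D.1.intersection α (p.parityCycle D) =
      -∑ k ∈ Finset.range D.1.word.length, c k •
        (p.strandPotential D.1.word true (k + 1) - p.strandPotential D.1.word true k) := by
  rw [← D.1.sum_pos, ← Finset.sum_neg_distrib, GaussDiagram.intersection]
  refine Finset.sum_congr rfl fun v _ => ?_
  have htt := p.val_eq_strandPotential_sub D v true true
  have hff := p.val_eq_strandPotential_sub D v false false
  have hft := p.val_eq_strandPotential_sub D v false true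
  simp only [Bool.not_true, Bool.not_false, Bool.toNat_true, Bool.toNat_false, add_zero]
    at htt hff hft
  have h1 : p.parityCycle D (D.1.outArc v false) =
      -(p.strandPotential D.1.word true (D.1.pos v true + 1) -
        p.strandPotential D.1.word true (D.1.pos v true)) := by
    rw [parityCycle_outArc]
    rw [hft] at htt
    rw [← sub_eq_zero] at htt ⊢
    rw [← htt]
    abel
  have h2 : p.parityCycle D (D.1.inArc v true) =
      p.strandPotential D.1.word true (D.1.pos v false + 1) -
        p.strandPotential D.1.word true (D.1.pos v false) := by
    rw [parityCycle_inArc]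
    rw [hft, eq_comm, ← sub_eq_zero] at hff
    rw [← sub_eq_zero, ← hff]
    abel
  rw [hout, hin, h1, h2, smul_neg, neg_add, sub_eq_add_neg]

theorem isNormalized_parityCycle : IsNormalized D.1 (p.parityCycle D) := by
  rw [IsNormalized, p.intersection_parityCycle D _ (fun _ => 1) (fun _ => rfl) (fun _ => rfl)]
  simp only [one_smul]
  rw [Finset.sum_range_sub, p.strandPotential_length ⟨D, rfl⟩, sub_self, neg_zero]

theorem val_eq_intersection (v : D.1.Crossing) :
    p.val D v = D.1.intersection (D.1.leftHalf v) (p.parityCycle D) := by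
  set B := D.1.pos v true with hB
  set C := D.1.pos v false with hC
  have hBn : B < D.1.word.length := D.1.pos_lt v true
  have hCn : C < D.1.word.length := D.1.pos_lt v false
  have hBC : ∀ v', D.1.pos v' true ≠ C := fun v' h => by simpa using (D.1.pos_inj h).2
  have hCB : ∀ v', D.1.pos v' false ≠ B := fun v' h => by simpa using (D.1.pos_inj h).2
  have hval := p.val_eq_strandPotential_sub D v false true
  simp only [Bool.not_false, Bool.toNat_true, Bool.toNat_false, add_zero, ← hB, ← hC] at hval
  rw [p.intersection_parityCycle D _ (fun k => if (if C < B then C < k ∧ k < B else C < k ∨ k < B)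
    then 1 else 0)]
  · simp only [ite_smul, one_smul, zero_smul]
    rw [← Finset.sum_filter, hval, eq_neg_iff_add_eq_zero]
    by_cases hlt : C < B
    · have hf : (Finset.range D.1.word.length).filter
          (fun k => if C < B then C < k ∧ k < B else C < k ∨ k < B) = Finset.Ico (C + 1) B := by
        ext k
        simp only [if_pos hlt, Finset.mem_filter, Finset.mem_range, Finset.mem_Ico]
        omega
      rw [hf, Finset.sum_Ico_sub _ (by omega)]
      abel
    · have hf : (Finset.range D.1.word.length).filter
          (fun k => if C < B then C < k ∧ k < B else C < k ∨ k < B) =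
          Finset.range B ∪ Finset.Ico (C + 1) D.1.word.length := by
        ext k
        simp only [if_neg hlt, Finset.mem_filter, Finset.mem_range, Finset.mem_Ico,
          Finset.mem_union]
        omega
      rw [hf, Finset.sum_union, Finset.sum_Ico_sub _ (by omega), Finset.sum_range_sub,
        p.strandPotential_length ⟨D, rfl⟩]
      · abel
      · rw [Finset.disjoint_left]
        intro k
        simp only [Finset.mem_range, Finset.mem_Ico]
        omega
  -- Along the strand going right the left half has to be read off after the crossing, along the
  -- other one before it: this leaves out the two passages through `v` itself.
  · intro v'
    have h1 := hBC v'
    have h2 := D.1.pos_lt v' true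
    simp only [GaussDiagram.leftHalf, D.1.outArc_val, ← hB, ← hC]
    refine if_congr ?_ rfl rfl
    split_ifs <;> omega
  · intro v'
    have h1 := hCB v'
    simp only [GaussDiagram.leftHalf, D.1.inArc_val, ← hB, ← hC]
    refine if_congr ?_ rfl rfl
    split_ifs <;> omega

end OrientedParity

end VirtualKnot

theorem mainTheorem1 {A : Type*} [AddCommGroup A] (K : VirtualKnot.Knot)
    (p : VirtualKnot.OrientedParity K A) :
    (∀ (D : VirtualKnot.Diagram K) (i : D.1.Arc) (o s : Bool),
      p.selfParity D i o s = p.potential D i) ∧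
    (∀ D : VirtualKnot.Diagram K, D.1.boundary (p.parityCycle D) = 0) ∧
    VirtualKnot.IsInvariant p.parityCycle ∧
    (∀ D : VirtualKnot.Diagram K, VirtualKnot.IsNormalized D.1 (p.parityCycle D)) ∧
    (∀ (D : VirtualKnot.Diagram K) (v : D.1.Crossing),
      p.val D v = D.1.intersection (D.1.leftHalf v) (p.parityCycle D)) :=
  ⟨fun D i o s => by rw [VirtualKnot.OrientedParity.potential, p.selfParity_eq, p.selfParity_eq],
    p.boundary_parityCycle, p.isInvariant_parityCycle, p.isNormalized_parityCycle,
    p.val_eq_intersection⟩
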